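/- Let $M$ be a von Neumann algebra acting on a complex Hilbert space $H$, and let $D\subseteq M$ be a Cartan MASA: $D$ is a maximal abelian self-adjoint subalgebra of $M$, there is a faithful normal conditional expectation of $M$ onto $D$, and the groupoid normalizers of $D$ in $M$, that is, the set $$G=\{v\in M:\ vv^*v=v,\ vDv^*\subseteq D,\ v^*Dv\subseteq D\},$$ span a weak-$*$ dense subspace of $M$. Then $G$ is an inverse monoid under multiplication, with $v^\dagger=v^*$. Let $S=G/R_M$ be its quotient by the Munn congruence $R_M=\{(v,w): vev^\dagger=wew^\dagger \text{ for all idempotents } e\in G\}$, let $\mathcal E(S)$ be the set of idempotents of the inverse monoid $S$, and order $S$ by $s\le t$ if and only if $s=te$ for some $e\in\mathcal E(S)$. Then $S$ is a Cartan inverse monoid, that is: 1. $S$ is fundamental: if $ses^\dagger=tet^\dagger$ for all $e\in\mathcal E(S)$, then $s=t$. 2. $S$ is a complete Boolean inverse monoid: $S$ has a zero; $\mathcal E(S)$ is a complete Boolean algebra; any two elements of $S$ have a meet; and every pairwise orthogonal family in $S$ (in particular any two orthogonal elements) has a join in $S$, where $s,t$ are orthogonal if $s^\dagger t=ts^\dagger=0$.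 3. The space of characters of $\mathcal E(S)$ (bounded lattice homomorphisms $\rho:\mathcal E(S)\to\{0,1\}$, with basis of open sets $\{\rho:\rho(e)=1\}$, $e\in\mathcal E(S)$) is hyperstonean: it is compact, Hausdorff and extremally disconnected, and for every nonzero continuous $f\ge 0$ there is a positive normal Radon measure $\mu$ with $\int f\,d\mu>0$. Here $\mu$ is normal if $\int \sup_i f_i\,d\mu=\sup_i\int f_i\,d\mu$ for every bounded increasing net $(f_i)$ of continuous real functions that has a supremum $\sup_i f_i$ in the ordered set of continuous real functions. -/

import Mathlib

universe u

noncomputable section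

/-! ### Inverse monoids -/

/-- An inverse monoid: a monoid in which every `s` has a unique generalized inverse `s⁻¹`,
that is, a unique element with `s * s⁻¹ * s = s` and `s⁻¹ * s * s⁻¹ = s⁻¹`. -/
class InverseMonoid (S : Type u) extends Monoid S, Inv S where
  mul_inv_mul : ∀ s : S, s * s⁻¹ * s = s
  inv_mul_inv : ∀ s : S, s⁻¹ * s * s⁻¹ = s⁻¹
  eq_inv : ∀ s t : S, s * t * s = s → t * s * t = t → t = s⁻¹

namespace InverseMonoid

/-- Generalized inverses are unique as soon as the idempotents commute. -/
theorem inv_unique_of_comm {S : Type u} [Monoid S]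
    (hc : ∀ e f : S, e * e = e → f * f = f → e * f = f * e)
    {s t t' : S} (h1 : s * t * s = s) (h2 : t * s * t = t)
    (h1' : s * t' * s = s) (h2' : t' * s * t' = t') : t = t' := by
  have a1 : (t * s) * (t * s) = t * s := by rw [← mul_assoc, h2]
  have a2 : (t' * s) * (t' * s) = t' * s := by rw [← mul_assoc, h2']
  have b1 : (s * t) * (s * t) = s * t := by rw [← mul_assoc, h1]
  have b2 : (s * t') * (s * t') = s * t' := by rw [← mul_assoc, h1']
  have e1 : t = t' * s * t := by
    calc t = t * (s * t' * s) * t := by rw [h1', h2]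
      _ = ((t * s) * (t' * s)) * t := by simp only [mul_assoc]
      _ = ((t' * s) * (t * s)) * t := by rw [hc _ _ a1 a2]
      _ = t' * s * (t * s * t) := by simp only [mul_assoc]
      _ = t' * s * t := by rw [h2]
  have e2 : t' = t' * s * t := by
    calc t' = t' * (s * t * s) * t' := by rw [h1, h2']
      _ = t' * ((s * t) * (s * t')) := by simp only [mul_assoc]
      _ = t' * ((s * t') * (s * t)) := by rw [hc _ _ b1 b2]
      _ = (t' * s * t') * s * t := by simp only [mul_assoc]
      _ = t' * s * t := by rw [h2']
  rw [e1, ← e2]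

variable {S : Type u} [InverseMonoid S]

theorem inv_inv' (s : S) : s⁻¹⁻¹ = s :=
  (eq_inv s⁻¹ s (inv_mul_inv s) (mul_inv_mul s)).symm

/-- Idempotents of an inverse monoid commute. -/
theorem idem_comm (e f : S) (he : e * e = e) (hf : f * f = f) : e * f = f * e := by
  have key : ∀ e f : S, e * e = e → f * f = f →
      (e * f)⁻¹ = e * f ∧ (e * f) * (e * f) = e * f := by
    intro e f he hf
    set x := (e * f)⁻¹ with hx
    have p1 : e * f * x * (e * f) = e * f := mul_inv_mul _
    have p2 : x * (e * f) * x = x := inv_mul_inv _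
    have q1 : (e * f) * (f * x * e) * (e * f) = e * f := by
      calc (e * f) * (f * x * e) * (e * f) = e * (f * f) * x * ((e * e) * f) := by
            simp only [mul_assoc]
        _ = e * f := by rw [he, hf, p1]
    have q2 : (f * x * e) * (e * f) * (f * x * e) = f * x * e := by
      calc (f * x * e) * (e * f) * (f * x * e) = f * (x * ((e * e) * (f * f)) * x) * e := by
            simp only [mul_assoc]
        _ = f * x * e := by rw [he, hf, p2]
    have hxe : f * x * e = x := eq_inv _ _ q1 q2
    have hxx : x * x = x := by
      calc x * x = (f * x * e) * (f * x * e) := by rw [hxe]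
        _ = f * (x * (e * f) * x) * e := by simp only [mul_assoc]
        _ = x := by rw [p2, hxe]
    have h3 : x = x⁻¹ := eq_inv x x (by rw [hxx, hxx]) (by rw [hxx, hxx])
    have h4 : x = e * f := by rw [h3, hx, inv_inv']
    exact ⟨h4, by rw [← h4]; exact hxx⟩
  obtain ⟨h1, h2⟩ := key e f he hf
  obtain ⟨-, h3⟩ := key f e hf he
  have : f * e = (e * f)⁻¹ := by
    apply eq_inv
    · calc e * f * (f * e) * (e * f) = e * (f * f) * ((e * e) * f) := by simp only [mul_assoc]
        _ = e * f := by rw [he, hf, h2]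
    · calc f * e * (e * f) * (f * e) = f * (e * e) * ((f * f) * e) := by simp only [mul_assoc]
        _ = f * e := by rw [he, hf, h3]
  rw [this, h1]

theorem inv_mul_idem (s : S) : (s⁻¹ * s) * (s⁻¹ * s) = s⁻¹ * s := by
  rw [← mul_assoc, inv_mul_inv]

theorem mul_inv_idem (s : S) : (s * s⁻¹) * (s * s⁻¹) = s * s⁻¹ := by
  rw [← mul_assoc, mul_inv_mul]

theorem mul_inv_rev' (s t : S) : (s * t)⁻¹ = t⁻¹ * s⁻¹ := by
  have hc := idem_comm (t * t⁻¹) (s⁻¹ * s) (mul_inv_idem t) (inv_mul_idem s)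
  symm
  apply eq_inv
  · calc s * t * (t⁻¹ * s⁻¹) * (s * t) = s * ((t * t⁻¹) * (s⁻¹ * s)) * t := by
          simp only [mul_assoc]
      _ = (s * s⁻¹ * s) * (t * t⁻¹ * t) := by rw [hc]; simp only [mul_assoc]
      _ = s * t := by rw [mul_inv_mul, mul_inv_mul]
  · calc t⁻¹ * s⁻¹ * (s * t) * (t⁻¹ * s⁻¹) = t⁻¹ * ((s⁻¹ * s) * (t * t⁻¹)) * s⁻¹ := by
          simp only [mul_assoc]
      _ = (t⁻¹ * t * t⁻¹) * (s⁻¹ * s * s⁻¹) := by rw [← hc]; simp only [mul_assoc]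
      _ = t⁻¹ * s⁻¹ := by rw [inv_mul_inv, inv_mul_inv]

theorem conj_idem (s e : S) (he : e * e = e) : (s * e * s⁻¹) * (s * e * s⁻¹) = s * e * s⁻¹ := by
  calc (s * e * s⁻¹) * (s * e * s⁻¹) = s * (e * (s⁻¹ * s)) * e * s⁻¹ := by
        simp only [mul_assoc]
    _ = (s * s⁻¹ * s) * (e * e) * s⁻¹ := by
        rw [idem_comm e _ he (inv_mul_idem s)]; simp only [mul_assoc]
    _ = s * e * s⁻¹ := by rw [he, mul_inv_mul]

/-- The natural partial order: `s ≤ t` when `s = t * e` for some idempotent `e`. -/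
instance naturalOrder : PartialOrder S where
  le s t := ∃ e : S, e * e = e ∧ s = t * e
  le_refl s := ⟨s⁻¹ * s, inv_mul_idem s, by rw [← mul_assoc, mul_inv_mul]⟩
  le_trans := by
    rintro s t r ⟨e, he, rfl⟩ ⟨f, hf, rfl⟩
    refine ⟨f * e, ?_, mul_assoc _ _ _⟩
    calc (f * e) * (f * e) = f * (e * f) * e := by simp only [mul_assoc]
      _ = (f * f) * (e * e) := by rw [idem_comm e f he hf]; simp only [mul_assoc]
      _ = f * e := by rw [he, hf]
  le_antisymm := by
    rintro s t ⟨e, he, hs⟩ ⟨f, hf, ht⟩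
    have h1 : s * e = s := by rw [hs, mul_assoc, he]
    calc s = t * e := hs
      _ = s * (f * e) := by rw [ht, mul_assoc]
      _ = s * e * f := by rw [idem_comm f e hf he, mul_assoc]
      _ = t := by rw [h1, ← ht]

variable (S) in
/-- The set of idempotents of `S`, with the order inherited from the natural partial order. -/
abbrev Idem : Type u := {e : S // e * e = e}

variable (S) in
/-- The Munn congruence: `s` and `t` are related when `s e s⁻¹ = t e t⁻¹` for every
idempotent `e`. -/
def munnCon : Con S where
  r s t := ∀ e : S, e * e = e → s * e * s⁻¹ = t * e * t⁻¹
  iseqv :=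
    { refl := fun _ _ _ => rfl
      symm := fun h e he => (h e he).symm
      trans := fun h h' e he => (h e he).trans (h' e he) }
  mul' := by
    intro w x y z h h' e he
    calc w * y * e * (w * y)⁻¹ = w * (y * e * y⁻¹) * w⁻¹ := by
          rw [mul_inv_rev']; simp only [mul_assoc]
      _ = x * (z * e * z⁻¹) * x⁻¹ := by rw [h' e he, h _ (conj_idem z e he)]
      _ = x * z * e * (x * z)⁻¹ := by rw [mul_inv_rev']; simp only [mul_assoc]

/-- Every idempotent of the quotient by the Munn congruence is the class of an idempotent. -/
theorem munnCon_idem_lift (a : (munnCon S).Quotient) (ha : a * a = a) :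
    ∃ e : S, e * e = e ∧ (e : (munnCon S).Quotient) = a := by
  induction a using Con.induction_on with
  | H x =>
    refine ⟨x * (x * x)⁻¹ * x, ?_, ?_⟩
    · calc x * (x * x)⁻¹ * x * (x * (x * x)⁻¹ * x)
          = x * ((x * x)⁻¹ * (x * x) * (x * x)⁻¹) * x := by simp only [mul_assoc]
        _ = x * (x * x)⁻¹ * x := by rw [inv_mul_inv]
    · have := congrArg (fun y : S => (y : (munnCon S).Quotient)) (mul_inv_mul (x * x))
      simp only [Con.coe_mul] at this ⊢
      rwa [ha] at this

theorem munnCon_idem_comm (a b : (munnCon S).Quotient) (ha : a * a = a) (hb : b * b = b) :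
    a * b = b * a := by
  obtain ⟨e, he, rfl⟩ := munnCon_idem_lift a ha
  obtain ⟨f, hf, rfl⟩ := munnCon_idem_lift b hb
  rw [← Con.coe_mul, ← Con.coe_mul, idem_comm e f he hf]

theorem munnCon_inv {s t : S} (h : munnCon S s t) : munnCon S s⁻¹ t⁻¹ := by
  have hst : (s : (munnCon S).Quotient) = t := (Con.eq _).2 h
  refine (Con.eq _).1 (inv_unique_of_comm munnCon_idem_comm
    (s := (s : (munnCon S).Quotient)) ?_ ?_ ?_ ?_)
  · rw [← Con.coe_mul, ← Con.coe_mul, mul_inv_mul]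
  · rw [← Con.coe_mul, ← Con.coe_mul, inv_mul_inv]
  · rw [hst, ← Con.coe_mul, ← Con.coe_mul, mul_inv_mul]
  · rw [hst, ← Con.coe_mul, ← Con.coe_mul, inv_mul_inv]

variable (S) in
/-- The quotient of an inverse monoid by its Munn congruence. -/
def MunnQuotient : Type u := (munnCon S).Quotient

/-- The quotient by the Munn congruence is an inverse monoid; the operations are those induced
from representatives. -/
instance munnQuotientInverseMonoid : InverseMonoid (MunnQuotient S) where
  toMonoid := inferInstanceAs (Monoid (munnCon S).Quotient)
  inv := Quotient.map' (fun s : S => s⁻¹) fun _ _ h => munnCon_inv h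
  mul_inv_mul a := Con.induction_on a fun x => by
    exact congrArg (fun y : S => (y : (munnCon S).Quotient)) (mul_inv_mul x)
  inv_mul_inv a := Con.induction_on a fun x => by
    exact congrArg (fun y : S => (y : (munnCon S).Quotient)) (inv_mul_inv x)
  eq_inv a t := Con.induction_on a fun x h1 h2 => by
    refine inv_unique_of_comm munnCon_idem_comm h1 h2
      (t' := ((x⁻¹ : S) : (munnCon S).Quotient)) ?_ ?_
    · exact congrArg (fun y : S => (y : (munnCon S).Quotient)) (mul_inv_mul x)
    · exact congrArg (fun y : S => (y : (munnCon S).Quotient)) (inv_mul_inv x)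

end InverseMonoid

/-! ### Boolean algebras and hyperstonean spaces -/

/-- The partially ordered set `L` is a Boolean algebra. -/
def IsBooleanAlgebra (L : Type u) [PartialOrder L] : Prop :=
  ∃ (B : Type u) (_ : BooleanAlgebra B), Nonempty (L ≃o B)

/-- A character of `L`: a homomorphism of bounded lattices from `L` to the two element lattice.
The lattice operations of `L` are expressed through its order. -/
@[ext]
structure LatticeCharacter (L : Type u) [PartialOrder L] where
  toFun : L → Bool
  map_inf : ∀ a b c : L, IsGLB {a, b} c → toFun c = (toFun a && toFun b)
  map_sup : ∀ a b c : L, IsLUB {a, b} c → toFun c = (toFun a || toFun b)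
  map_top : ∀ a : L, IsTop a → toFun a = true
  map_bot : ∀ a : L, IsBot a → toFun a = false

/-- The topology of the character space, with basis the sets `{ρ | ρ e = 1}`, for `e` in `L`. -/
instance (L : Type u) [PartialOrder L] : TopologicalSpace (LatticeCharacter L) :=
  TopologicalSpace.generateFrom (Set.range fun e : L => {ρ | ρ.toFun e = true})

/-- A positive Radon measure on a compact Hausdorff space is normal if it preserves the suprema
(in the ordered set of continuous real functions) of bounded upward directed families. -/
structure IsNormalMeasure {X : Type u} [TopologicalSpace X] [MeasurableSpace X] [BorelSpace X]
    (μ : MeasureTheory.Measure X) : Prop where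
  finite : MeasureTheory.IsFiniteMeasure μ
  regular : μ.Regular
  isLUB_integral : ∀ (F : Set C(X, ℝ)) (f : C(X, ℝ)), F.Nonempty → DirectedOn (· ≤ ·) F →
    IsLUB F f → IsLUB ((fun g : C(X, ℝ) => ∫ x, g x ∂μ) '' F) (∫ x, f x ∂μ)

/-- A hyperstonean space: an extremally disconnected compact Hausdorff space with sufficiently
many positive normal measures. -/
structure IsHyperstonean (X : Type u) [TopologicalSpace X] : Prop where
  compact : CompactSpace X
  t2 : T2Space X
  extremallyDisconnected : ExtremallyDisconnected X
  exists_normal : letI : MeasurableSpace X := borel X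
    haveI : BorelSpace X := ⟨rfl⟩
    ∀ f : C(X, ℝ), 0 ≤ f → f ≠ 0 →
      ∃ μ : MeasureTheory.Measure X, IsNormalMeasure μ ∧ 0 < ∫ x, f x ∂μ

/-! ### Cartan inverse monoids -/

namespace InverseMonoid

/-- `z` is a zero element. -/
def IsZeroElem {S : Type u} [InverseMonoid S] (z : S) : Prop :=
  ∀ s : S, s * z = z ∧ z * s = z

/-- `s` and `t` are orthogonal: `s⁻¹ * t = 0 = t * s⁻¹`. -/
def Orthogonal {S : Type u} [InverseMonoid S] (s t : S) : Prop :=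
  IsZeroElem (s⁻¹ * t) ∧ IsZeroElem (t * s⁻¹)

/-- An inverse monoid is fundamental if its elements are determined by their conjugation action
on idempotents. -/
def IsFundamental (S : Type u) [InverseMonoid S] : Prop :=
  ∀ s t : S, (∀ e : S, e * e = e → s * e * s⁻¹ = t * e * t⁻¹) → s = t

/-- Boolean inverse monoids; all order notions refer to the natural partial order. -/
structure IsBoolean (S : Type u) [InverseMonoid S] : Prop where
  exists_zero : ∃ z : S, IsZeroElem z
  idem_boolean : IsBooleanAlgebra (Idem S)
  exists_meet : ∀ s t : S, ∃ m : S, IsGLB {s, t} m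
  exists_join : ∀ s t : S, Orthogonal s t → ∃ j : S, IsLUB {s, t} j

/-- Complete Boolean inverse monoids: the idempotents form a complete Boolean algebra and every
pairwise orthogonal family has a join. -/
structure IsCompleteBoolean (S : Type u) [InverseMonoid S] : Prop extends IsBoolean S where
  idem_complete : ∀ A : Set (Idem S), ∃ e : Idem S, IsLUB A e
  exists_sSup : ∀ A : Set S, A.Pairwise Orthogonal → ∃ j : S, IsLUB A j

/-- Cartan inverse monoids. -/
structure IsCartan (S : Type u) [InverseMonoid S] : Prop where
  fundamental : IsFundamental S
  completeBoolean : IsCompleteBoolean S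
  hyperstonean : IsHyperstonean (LatticeCharacter (Idem S))

end InverseMonoid

/-! ### Cartan pairs of von Neumann algebras -/

section CartanPair

variable {H : Type u} [NormedAddCommGroup H] [InnerProductSpace ℂ H] [CompleteSpace H]

variable (H) in
/-- The weak-* (ultraweak) topology on the bounded operators, that is, the coarsest topology for
which the functionals `T ↦ ∑ ⟪ξ n, T (η n)⟫`, with `ξ` and `η` square summable, are continuous.
The weak-* topology of a von Neumann algebra acting on `H` is the subspace topology. -/
@[reducible]
def ultraweak : TopologicalSpace (H →L[ℂ] H) :=
  ⨅ (ξ : lp (fun _ : ℕ => H) 2) (η : lp (fun _ : ℕ => H) 2),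
    TopologicalSpace.induced (fun T : H →L[ℂ] H => ∑' n, inner ℂ (ξ n) (T (η n))) inferInstance

/-- `D` is a maximal abelian self-adjoint subalgebra of `M`. -/
def IsMASA (M : VonNeumannAlgebra H) (D : StarSubalgebra ℂ (H →L[ℂ] H)) : Prop :=
  Maximal (fun A : StarSubalgebra ℂ (H →L[ℂ] H) =>
    A ≤ M.toStarSubalgebra ∧ ∀ x ∈ A, ∀ y ∈ A, x * y = y * x) D

/-- The groupoid normalizers of `D` in `M`: the partial isometries `v` in `M` with
`v D v* ⊆ D` and `v* D v ⊆ D`. -/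
def groupoidNormalizers (M : VonNeumannAlgebra H) (D : StarSubalgebra ℂ (H →L[ℂ] H)) :
    Set (H →L[ℂ] H) :=
  {v | v ∈ M ∧ v * star v * v = v ∧ ∀ d ∈ D, v * d * star v ∈ D ∧ star v * d * v ∈ D}

/-- `E` is a faithful normal conditional expectation of `M` onto `D`. -/
structure IsFaithfulNormalCondExp (M : VonNeumannAlgebra H) (D : StarSubalgebra ℂ (H →L[ℂ] H))
    (E : M.toStarSubalgebra →ₗ[ℂ] D) : Prop where
  apply_mem : ∀ x : M.toStarSubalgebra, (x : H →L[ℂ] H) ∈ D → (E x : H →L[ℂ] H) = x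
  positive : ∀ x : M.toStarSubalgebra,
    (x : H →L[ℂ] H).IsPositive → (E x : H →L[ℂ] H).IsPositive
  bimodule : ∀ a x b : M.toStarSubalgebra, (a : H →L[ℂ] H) ∈ D → (b : H →L[ℂ] H) ∈ D →
    (E (a * x * b) : H →L[ℂ] H) = a * E x * b
  faithful : ∀ x : M.toStarSubalgebra, E (star x * x) = 0 → x = 0
  normal : @Continuous M.toStarSubalgebra D ((ultraweak H).induced Subtype.val)
    ((ultraweak H).induced Subtype.val) E

variable (H) in
/-- A Cartan pair: a von Neumann algebra `M` acting on `H` with a Cartan MASA `D`. -/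
structure CartanPair where
  M : VonNeumannAlgebra H
  D : StarSubalgebra ℂ (H →L[ℂ] H)
  isMASA : IsMASA M D
  exists_condExp : ∃ E : M.toStarSubalgebra →ₗ[ℂ] D, IsFaithfulNormalCondExp M D E
  dense_normalizers : (M : Set (H →L[ℂ] H)) ⊆
    @closure _ (ultraweak H) (Submodule.span ℂ (groupoidNormalizers M D) : Set (H →L[ℂ] H))

namespace CartanPair

variable (P : CartanPair H)

theorem D_le : ∀ x ∈ P.D, x ∈ P.M := fun _ hx => P.isMASA.prop.1 hx

theorem D_comm : ∀ x ∈ P.D, ∀ y ∈ P.D, x * y = y * x := P.isMASA.prop.2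

/-- The inverse monoid of groupoid normalizers. -/
def G : Type u := groupoidNormalizers P.M P.D

theorem star_mul_self_mem {v : H →L[ℂ] H} (hv : v ∈ groupoidNormalizers P.M P.D) :
    star v * v ∈ P.D ∧ v * star v ∈ P.D := by
  have := hv.2.2 1 (one_mem _)
  simpa [and_comm] using this

theorem one_mem_gn : (1 : H →L[ℂ] H) ∈ groupoidNormalizers P.M P.D :=
  ⟨one_mem _, by simp, fun d hd => by simpa using hd⟩

theorem star_partial {v : H →L[ℂ] H} (hv : v * star v * v = v) :
    star v * v * star v = star v := by
  have := congrArg star hv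
  simpa [mul_assoc] using this

theorem star_mem_gn {v : H →L[ℂ] H} (hv : v ∈ groupoidNormalizers P.M P.D) :
    star v ∈ groupoidNormalizers P.M P.D :=
  ⟨star_mem hv.1, by rw [star_star]; exact star_partial hv.2.1,
    fun d hd => by rw [star_star]; exact (hv.2.2 d hd).symm⟩

theorem mul_mem_gn {v w : H →L[ℂ] H} (hv : v ∈ groupoidNormalizers P.M P.D)
    (hw : w ∈ groupoidNormalizers P.M P.D) : v * w ∈ groupoidNormalizers P.M P.D := by
  refine ⟨mul_mem hv.1 hw.1, ?_, fun d hd => ⟨?_, ?_⟩⟩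
  · have hc := P.D_comm _ (P.star_mul_self_mem hv).1 _ (P.star_mul_self_mem hw).2
    calc v * w * star (v * w) * (v * w) = v * ((w * star w) * (star v * v)) * w := by
          rw [star_mul]; simp only [mul_assoc]
      _ = (v * star v * v) * (w * star w * w) := by rw [← hc]; simp only [mul_assoc]
      _ = v * w := by rw [hv.2.1, hw.2.1]
  · have := (hv.2.2 _ (hw.2.2 d hd).1).1
    simpa only [star_mul, mul_assoc] using this
  · have := (hw.2.2 _ (hv.2.2 d hd).2).2
    simpa only [star_mul, mul_assoc] using this

/-- Idempotent groupoid normalizers lie in `D`. -/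
theorem idem_mem_D {e : H →L[ℂ] H} (he : e ∈ groupoidNormalizers P.M P.D) (hee : e * e = e) :
    e ∈ P.D := by
  have hc := P.D_comm _ (P.star_mul_self_mem he).1 _ (P.star_mul_self_mem he).2
  have hss : star e * star e = star e := by rw [← star_mul, hee]
  have h1 : (star e * e) * (e * star e) = star e := by
    calc (star e * e) * (e * star e) = star e * (e * e) * star e := by simp only [mul_assoc]
      _ = star e := by rw [hee, star_partial he.2.1]
  have h2 : (e * star e) * (star e * e) = e := by
    calc (e * star e) * (star e * e) = e * (star e * star e) * e := by simp only [mul_assoc]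
      _ = e := by rw [hss, he.2.1]
  have h3 : star e = e := by rw [← h1, hc, h2]
  have := (P.star_mul_self_mem he).1
  rwa [h3, hee] at this

instance : Monoid P.G where
  mul v w := ⟨v.1 * w.1, P.mul_mem_gn v.2 w.2⟩
  one := ⟨1, P.one_mem_gn⟩
  mul_assoc u v w := Subtype.ext (mul_assoc u.1 v.1 w.1)
  one_mul v := Subtype.ext (one_mul v.1)
  mul_one v := Subtype.ext (mul_one v.1)

theorem G_idem_comm (e f : P.G) (he : e * e = e) (hf : f * f = f) : e * f = f * e :=
  Subtype.ext (P.D_comm _ (P.idem_mem_D e.2 (congrArg Subtype.val he))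
    _ (P.idem_mem_D f.2 (congrArg Subtype.val hf)))

/-- The groupoid normalizers form an inverse monoid under multiplication of operators, with the
adjoint as inverse. -/
instance : InverseMonoid P.G where
  inv v := ⟨star v.1, P.star_mem_gn v.2⟩
  mul_inv_mul v := Subtype.ext v.2.2.1
  inv_mul_inv v := Subtype.ext (star_partial v.2.2.1)
  eq_inv v _ h1 h2 := InverseMonoid.inv_unique_of_comm P.G_idem_comm h1 h2
    (Subtype.ext v.2.2.1) (Subtype.ext (star_partial v.2.2.1))

/-- The quotient of the groupoid normalizers by the Munn congruence. -/
abbrev S : Type u := InverseMonoid.MunnQuotient P.G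

end CartanPair

end CartanPair

end

/-!
Passing to the Munn quotient does not change the idempotents and makes the monoid fundamental. The
idempotents of `G` are the projections of `D`, so they form the Boolean algebra of clopen sets of
the Gelfand spectrum of `D`, which is at the same time the character space of that Boolean algebra.
It is extremally disconnected because `D` contains the left supports of its subsets, and vector
states are normal measures on it by Vigier's theorem; this settles the idempotents. For the rest,
conjugation by `s` preserves joins of idempotents, so in a fundamental monoid elements which agree
on a family of idempotents agree on its join. Hence the meet of `s` and `t` is their restriction to
the largest idempotent on which they agree, and an orthogonal family has a join once it has an upper
bound whose source is the join of the sources. A weak operator limit of the finite partial sums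
provides that upper bound.
-/

namespace InverseMonoid

section Order

variable {S : Type u} [InverseMonoid S]

theorem inv_eq_self_of_idem {e : S} (he : e * e = e) : e⁻¹ = e :=
  (eq_inv e e (by rw [he, he]) (by rw [he, he])).symm

theorem le_iff_eq_mul_inv_mul {s t : S} : s ≤ t ↔ s = t * (s⁻¹ * s) := by
  refine ⟨?_, fun h => ⟨s⁻¹ * s, inv_mul_idem s, h⟩⟩
  rintro ⟨e, he, rfl⟩
  calc t * e = t * (t⁻¹ * t * e) := by rw [← mul_assoc t, ← mul_assoc t, mul_inv_mul]
    _ = t * (e * (t⁻¹ * t) * e) := by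
      rw [idem_comm e _ he (inv_mul_idem t), mul_assoc _ e, he]
    _ = t * ((t * e)⁻¹ * (t * e)) := by
      rw [mul_inv_rev', inv_eq_self_of_idem he]; simp only [mul_assoc]

theorem idem_le_iff {e f : Idem S} : e ≤ f ↔ (f * e : S) = e := by
  change (e : S) ≤ f ↔ _
  rw [le_iff_eq_mul_inv_mul, inv_eq_self_of_idem e.2, e.2, eq_comm]

instance : SemilatticeInf (Idem S) where
  inf e f := ⟨e * f, by
    rw [mul_assoc, ← mul_assoc (f : S), idem_comm _ _ f.2 e.2, mul_assoc, f.2, ← mul_assoc, e.2]⟩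
  inf_le_left e f := idem_le_iff.2 (show (e * (e * f) : S) = e * f by rw [← mul_assoc, e.2])
  inf_le_right e f := ⟨e, e.2, idem_comm _ _ e.2 f.2⟩
  le_inf e f g hef heg := idem_le_iff.2 (by rw [mul_assoc, idem_le_iff.1 heg, idem_le_iff.1 hef])

/-- The idempotent `s⁻¹ * s`, the domain of `s` when `s` is regarded as a partial bijection. -/
def source (s : S) : Idem S := ⟨s⁻¹ * s, inv_mul_idem s⟩

theorem mul_source (s : S) : s * source s = s := by
  rw [source, ← mul_assoc, mul_inv_mul]

theorem le_iff_mul_source_eq {s t : S} : s ≤ t ↔ t * source s = s :=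
  le_iff_eq_mul_inv_mul.trans eq_comm

/-- The action `e ↦ s * e * s⁻¹` of `s` on idempotents, the direct image under the partial
bijection `s`. -/
def conj (s : S) (e : Idem S) : Idem S := ⟨s * e * s⁻¹, conj_idem s e e.2⟩

theorem conj_mul (s t : S) (e : Idem S) : conj (s * t) e = conj s (conj t e) :=
  Subtype.ext (by simp only [conj, mul_inv_rev', mul_assoc])

theorem conj_idem_eq_inf (e f : Idem S) : conj (e : S) f = e ⊓ f :=
  Subtype.ext <| show (e * f * (e : S)⁻¹ : S) = e * f by
    rw [inv_eq_self_of_idem e.2, idem_comm _ _ e.2 f.2, mul_assoc, e.2]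

theorem conj_mul_idem_comm (s : S) (e f : Idem S) : conj (s * e) f = conj (s * f) e := by
  rw [conj_mul, conj_mul, conj_idem_eq_inf, conj_idem_eq_inf, inf_comm]

theorem conj_mono (s : S) : Monotone (conj s) := fun e f h => idem_le_iff.2 <|
  calc s * f * s⁻¹ * (s * e * s⁻¹) = s * (f * (s⁻¹ * s)) * e * s⁻¹ := by simp only [mul_assoc]
    _ = (s * s⁻¹ * s) * (f * e) * s⁻¹ := by
      rw [idem_comm _ _ f.2 (inv_mul_idem s)]; simp only [mul_assoc]
    _ = s * e * s⁻¹ := by rw [mul_inv_mul, idem_le_iff.1 h]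

theorem conj_inv_conj (s : S) (e : Idem S) : conj s⁻¹ (conj s e) = source s ⊓ e := by
  rw [← conj_mul, ← conj_idem_eq_inf]; rfl

theorem conj_conj_inv_le (s : S) (e : Idem S) : conj s (conj s⁻¹ e) ≤ e := by
  have h := conj_inv_conj s⁻¹ e
  rw [inv_inv'] at h
  exact h.trans_le inf_le_right

theorem conj_source_inf (s : S) (e : Idem S) : conj s (source s ⊓ e) = conj s e := by
  rw [← conj_idem_eq_inf, ← conj_mul, mul_source]

theorem conj_le_iff (s : S) (e f : Idem S) : conj s e ≤ f ↔ source s ⊓ e ≤ conj s⁻¹ f := by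
  constructor
  · intro h
    rw [← conj_inv_conj]
    exact conj_mono _ h
  · intro h
    rw [← conj_source_inf]
    exact (conj_mono s h).trans (conj_conj_inv_le s f)

/-- Heyting implication provides a right adjoint of the conjugation action. -/
theorem isLUB_conj_image (hB : IsBooleanAlgebra (Idem S)) (s : S) {E : Set (Idem S)} {q : Idem S}
    (h : IsLUB E q) : IsLUB (conj s '' E) (conj s q) := by
  obtain ⟨B, _, ⟨φ⟩⟩ := hB
  have gc : GaloisConnection (conj s) fun f => φ.symm (φ (source s) ⇨ φ (conj s⁻¹ f)) := by
    intro e f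
    rw [conj_le_iff, ← φ.le_iff_le, map_inf, ← le_himp_iff', φ.le_symm_apply]
  exact gc.isLUB_l_image h

theorem IsZeroElem.eq {z w : S} (hz : IsZeroElem z) (hw : IsZeroElem w) : z = w :=
  (hz w).2.symm.trans (hw z).1

theorem IsZeroElem.inv {z : S} (hz : IsZeroElem z) : IsZeroElem z⁻¹ := by
  rwa [inv_eq_self_of_idem (hz z).1]

theorem Orthogonal.symm {s t : S} (h : Orthogonal s t) : Orthogonal t s := by
  constructor
  · simpa only [mul_inv_rev', inv_inv'] using h.1.inv
  · simpa only [mul_inv_rev', inv_inv'] using h.2.inv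

variable (S) in
/-- Every pairwise orthogonal family has an upper bound whose source is the join of the sources
of the family: the partial bijections of the family can be glued. -/
def HasOrthogonalGluing : Prop :=
  ∀ A : Set S, A.Pairwise Orthogonal →
    ∃ j ∈ upperBounds A, IsLUB (source '' A) (source j)

end Order

section Fundamental

variable {S : Type u} [InverseMonoid S]

theorem IsFundamental.ext (hS : IsFundamental S) {s t : S} (h : ∀ e, conj s e = conj t e) :
    s = t :=
  hS s t fun e he => congrArg Subtype.val (h ⟨e, he⟩)

theorem IsFundamental.mul_eq_mul_of_isLUB (hS : IsFundamental S)
    (hB : IsBooleanAlgebra (Idem S)) {s t : S} {E : Set (Idem S)} {q : Idem S} (hq : IsLUB E q)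
    (h : ∀ e ∈ E, s * e = t * e) : s * q = t * q := by
  refine hS.ext fun g => ?_
  have hE : conj (s * g) '' E = conj (t * g) '' E := Set.image_congr fun e he => by
    rw [conj_mul_idem_comm, h e he, conj_mul_idem_comm]
  rw [conj_mul_idem_comm, conj_mul_idem_comm t]
  exact (isLUB_conj_image hB _ hq).unique (hE ▸ isLUB_conj_image hB _ hq)

theorem IsFundamental.exists_isGLB_pair (hS : IsFundamental S) (hB : IsBooleanAlgebra (Idem S))
    (hC : ∀ E : Set (Idem S), ∃ e, IsLUB E e) (s t : S) : ∃ m, IsGLB {s, t} m := by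
  obtain ⟨q, hq⟩ := hC {e | s * (e : S) = t * e}
  have hst : s * q = t * q := hS.mul_eq_mul_of_isLUB hB hq fun e he => he
  refine ⟨s * q, ?_, fun r hr => ?_⟩
  · rintro _ (rfl | rfl)
    exacts [⟨q, q.2, rfl⟩, ⟨q, q.2, hst⟩]
  · have hs : s * source r = r := le_iff_mul_source_eq.1 (hr (Or.inl rfl))
    have ht : t * source r = r := le_iff_mul_source_eq.1 (hr (Or.inr rfl))
    have hle : source r ≤ q := hq.1 (hs.trans ht.symm)
    exact ⟨source r, (source r).2, by rw [mul_assoc, idem_le_iff.1 hle, hs]⟩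

theorem IsFundamental.isLUB_of_isLUB_source (hS : IsFundamental S)
    (hB : IsBooleanAlgebra (Idem S)) {A : Set S} {j : S} (hj : j ∈ upperBounds A)
    (h : IsLUB (source '' A) (source j)) : IsLUB A j := by
  refine ⟨hj, fun k hk => le_iff_mul_source_eq.2 ?_⟩
  have hjk : ∀ e ∈ source '' A, k * (e : S) = j * e := by
    rintro _ ⟨a, ha, rfl⟩
    rw [le_iff_mul_source_eq.1 (hk ha), le_iff_mul_source_eq.1 (hj ha)]
  rw [hS.mul_eq_mul_of_isLUB hB h hjk, mul_source]

theorem IsFundamental.isCompleteBoolean (hS : IsFundamental S) (hz : ∃ z : S, IsZeroElem z)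
    (hB : IsBooleanAlgebra (Idem S)) (hC : ∀ E : Set (Idem S), ∃ e, IsLUB E e)
    (hG : HasOrthogonalGluing S) : IsCompleteBoolean S := by
  have hsup : ∀ A : Set S, A.Pairwise Orthogonal → ∃ j, IsLUB A j := fun A hA =>
    let ⟨j, hj, hjA⟩ := hG A hA
    ⟨j, hS.isLUB_of_isLUB_source hB hj hjA⟩
  exact
    { exists_zero := hz
      idem_boolean := hB
      exists_meet := hS.exists_isGLB_pair hB hC
      exists_join := fun s t hst => hsup {s, t} (Set.pairwise_pair.2 fun _ => ⟨hst, hst.symm⟩)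
      idem_complete := hC
      exists_sSup := hsup }

end Fundamental

namespace MunnQuotient

variable {S : Type u} [InverseMonoid S]

/-- The quotient map. -/
def mk : S →* MunnQuotient S := (munnCon S).mk'

theorem mk_surjective : Function.Surjective (mk : S → MunnQuotient S) := Con.mk'_surjective

theorem mk_inv (s : S) : mk s⁻¹ = (mk s)⁻¹ := rfl

theorem mk_eq_mk {s t : S} : mk s = mk t ↔ munnCon S s t := (munnCon S).eq

theorem mk_injOn_idem {e f : S} (he : e * e = e) (hf : f * f = f) (h : mk e = mk f) : e = f := by
  simpa only [mul_one, inv_eq_self_of_idem he, inv_eq_self_of_idem hf, he, hf]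
    using mk_eq_mk.1 h 1 (one_mul 1)

theorem mk_mono {s t : S} (h : s ≤ t) : mk s ≤ mk t := by
  obtain ⟨e, he, rfl⟩ := h
  exact ⟨mk e, by rw [← map_mul, he], map_mul mk t e⟩

variable (S) in
/-- The quotient map does not identify idempotents, and all idempotents of the quotient come from
idempotents of `S`. -/
noncomputable def idemIso : Idem S ≃o Idem (MunnQuotient S) :=
  RelIso.ofSurjective
    (OrderEmbedding.ofMapLEIff
      (fun e : Idem S => (⟨mk e, by rw [← map_mul, e.2]⟩ : Idem (MunnQuotient S)))
      fun e f => by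
        rw [idem_le_iff, idem_le_iff, ← map_mul]
        exact ⟨mk_injOn_idem (f ⊓ e).2 e.2, congrArg mk⟩)
    fun a => let ⟨e, he, hea⟩ := munnCon_idem_lift a.1 a.2; ⟨⟨e, he⟩, Subtype.ext hea⟩

theorem source_mk (s : S) : source (mk s) = idemIso S (source s) := rfl

variable (S) in
theorem isFundamental : IsFundamental (MunnQuotient S) := by
  intro a b h
  obtain ⟨s, rfl⟩ := mk_surjective a
  obtain ⟨t, rfl⟩ := mk_surjective b
  refine mk_eq_mk.2 fun e he => mk_injOn_idem (conj_idem s e he) (conj_idem t e he) ?_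
  simpa only [map_mul, mk_inv] using h (mk e) (by rw [← map_mul, he])

theorem isZeroElem_mk {z : S} (hz : IsZeroElem z) : IsZeroElem (mk z) := by
  intro a
  obtain ⟨s, rfl⟩ := mk_surjective a
  rw [← map_mul, ← map_mul, (hz s).1, (hz s).2]
  exact ⟨rfl, rfl⟩

theorem isZeroElem_of_mk {z s : S} (hz : IsZeroElem z) (hs : IsZeroElem (mk s)) :
    IsZeroElem s := by
  have hconj : s * 1 * s⁻¹ = z * 1 * z⁻¹ :=
    mk_eq_mk.1 (hs.eq (isZeroElem_mk hz)) 1 (one_mul 1)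
  have hsz : s * s⁻¹ = z := by rwa [mul_one, mul_one, (hz z⁻¹).2] at hconj
  rwa [← mul_inv_mul s, hsz, (hz s).2]

theorem orthogonal_of_mk {z s t : S} (hz : IsZeroElem z) (h : Orthogonal (mk s) (mk t)) :
    Orthogonal s t :=
  ⟨isZeroElem_of_mk hz h.1, isZeroElem_of_mk hz h.2⟩

theorem hasOrthogonalGluing {z : S} (hz : IsZeroElem z) (hG : HasOrthogonalGluing S) :
    HasOrthogonalGluing (MunnQuotient S) := by
  intro A hA
  obtain ⟨lift, hlift⟩ := mk_surjective (S := S).hasRightInverse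
  have hA' : (lift '' A).Pairwise Orthogonal := by
    rintro _ ⟨a, ha, rfl⟩ _ ⟨b, hb, rfl⟩ hab
    refine orthogonal_of_mk hz ?_
    rw [hlift, hlift]
    exact hA ha hb (ne_of_apply_ne lift hab)
  obtain ⟨j, hj, hjA⟩ := hG _ hA'
  refine ⟨mk j, fun a ha => hlift a ▸ mk_mono (hj ⟨a, ha, rfl⟩), ?_⟩
  have himage : source '' A = idemIso S '' (source '' (lift '' A)) := by
    simp only [Set.image_image, ← source_mk, hlift _]
  rw [himage, source_mk]
  exact (idemIso S).isLUB_image'.2 hjA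

end MunnQuotient

end InverseMonoid

open TopologicalSpace MeasureTheory

section Hyperstonean

variable {X Y : Type u} [TopologicalSpace X] [TopologicalSpace Y]

theorem IsNormalMeasure.map [MeasurableSpace X] [BorelSpace X] [MeasurableSpace Y] [BorelSpace Y]
    {μ : Measure X} (hμ : IsNormalMeasure μ) (e : X ≃ₜ Y) : IsNormalMeasure (μ.map e) := by
  have := hμ.finite
  have := hμ.regular
  refine ⟨inferInstance, Measure.Regular.map e, fun F f hF hdir hf => ?_⟩
  let pull : C(Y, ℝ) → C(X, ℝ) := fun g => g.comp e
  have hpull : IsLUB (pull '' F) (pull f) := by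
    refine ⟨?_, fun g hg x => ?_⟩
    · rintro _ ⟨g, hg, rfl⟩ x
      exact hf.1 hg (e x)
    · have hfg : f ≤ g.comp e.symm := hf.2 fun k hk y => by
        simpa [pull] using hg ⟨k, hk, rfl⟩ (e.symm y)
      simpa [pull] using hfg (e x)
  have hdir' : DirectedOn (· ≤ ·) (pull '' F) :=
    directedOn_image.2 (hdir.mono fun _ _ h x => h (e x))
  simpa only [Set.image_image, e.measurableEmbedding.integral_map, pull, ContinuousMap.comp_apply,
    ContinuousMap.coe_coe] using hμ.isLUB_integral _ _ (hF.image pull) hdir' hpull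

theorem IsHyperstonean.of_homeomorph (h : IsHyperstonean X) (e : X ≃ₜ Y) : IsHyperstonean Y where
  compact := have := h.compact; e.compactSpace
  t2 := have := h.t2; e.t2Space
  extremallyDisconnected :=
    have := h.extremallyDisconnected; extremallyDisconnected_of_homeo e
  exists_normal := by
    let _ : MeasurableSpace X := borel X
    have _ : BorelSpace X := ⟨rfl⟩
    let _ : MeasurableSpace Y := borel Y
    have _ : BorelSpace Y := ⟨rfl⟩
    intro f hf0 hf
    obtain ⟨μ, hμ, hpos⟩ := h.exists_normal (f.comp e) (fun x => hf0 (e x))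
      fun h0 => hf (ContinuousMap.ext fun y => by
        simpa using congrArg (fun g : C(X, ℝ) => g (e.symm y)) h0)
    exact ⟨μ.map e, hμ.map e, by rwa [e.measurableEmbedding.integral_map]⟩

theorem exists_isLUB_clopens [ExtremallyDisconnected X] (A : Set (Clopens X)) :
    ∃ U, IsLUB A U := by
  have hopen : IsOpen (⋃ V ∈ A, (V : Set X)) := isOpen_biUnion fun V _ => V.isClopen.isOpen
  refine ⟨⟨closure (⋃ V ∈ A, (V : Set X)), isClosed_closure,
    ExtremallyDisconnected.open_closure _ hopen⟩, fun V hV => ?_, fun W hW => ?_⟩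
  · exact (Set.subset_biUnion_of_mem (u := fun V : Clopens X => (V : Set X)) hV).trans
      subset_closure
  · exact closure_minimal (Set.iUnion₂_subset fun V hV => hW hV) W.isClopen.isClosed

end Hyperstonean

namespace LatticeCharacter

section Transport

variable {L L' : Type u} [PartialOrder L] [PartialOrder L']

/-- Precomposition of a character with an order isomorphism. -/
def comap (φ : L ≃o L') (ρ : LatticeCharacter L') : LatticeCharacter L where
  toFun a := ρ.toFun (φ a)
  map_inf a b c h := ρ.map_inf _ _ _ (by rw [← Set.image_pair]; exact φ.isGLB_image'.2 h)
  map_sup a b c h := ρ.map_sup _ _ _ (by rw [← Set.image_pair]; exact φ.isLUB_image'.2 h)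
  map_top a h := ρ.map_top _ fun b => φ.symm_apply_le.1 (h _)
  map_bot a h := ρ.map_bot _ fun b => φ.le_symm_apply.1 (h _)

theorem continuous_comap (φ : L ≃o L') : Continuous (comap φ) := by
  refine continuous_generateFrom_iff.2 ?_
  rintro _ ⟨a, rfl⟩
  exact isOpen_generateFrom_of_mem ⟨φ a, rfl⟩

/-- Order isomorphic lattices have homeomorphic character spaces. -/
def homeomorphOfOrderIso (φ : L ≃o L') : LatticeCharacter L ≃ₜ LatticeCharacter L' where
  toFun := comap φ.symm
  invFun := comap φ
  left_inv ρ := by ext a; simp [comap]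
  right_inv ρ := by ext a; simp [comap]
  continuous_toFun := continuous_comap φ.symm
  continuous_invFun := continuous_comap φ

end Transport

theorem toFun_compl {L : Type u} [BooleanAlgebra L] (ρ : LatticeCharacter L) (a : L) :
    ρ.toFun aᶜ = !ρ.toFun a := by
  have hinf := ρ.map_inf a aᶜ ⊥ (by rw [← inf_compl_self a]; exact isGLB_pair)
  have hsup := ρ.map_sup a aᶜ ⊤ (by rw [← sup_compl_eq_top (x := a)]; exact isLUB_pair)
  rw [ρ.map_bot ⊥ isBot_bot] at hinf
  rw [ρ.map_top ⊤ isTop_top] at hsup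
  revert hinf hsup
  cases ρ.toFun a <;> cases ρ.toFun aᶜ <;> decide

section StoneDuality

variable {X : Type u} [TopologicalSpace X]

open Classical in
/-- The character of the clopen algebra given by evaluation at a point. -/
noncomputable def ofPoint (x : X) : LatticeCharacter (Clopens X) where
  toFun U := decide (x ∈ U)
  map_inf U V W h := by
    obtain rfl := h.unique isGLB_pair
    exact decide_eq_decide.2 Iff.rfl |>.trans (Bool.decide_and (x ∈ U) (x ∈ V))
  map_sup U V W h := by
    obtain rfl := h.unique isLUB_pair
    exact decide_eq_decide.2 Iff.rfl |>.trans (Bool.decide_or (x ∈ U) (x ∈ V))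
  map_top U h := decide_eq_true (h ⊤ (Set.mem_univ x))
  map_bot U h := decide_eq_false fun hx => h ⊥ hx

theorem ofPoint_eq_true {x : X} {U : Clopens X} : (ofPoint x).toFun U = true ↔ x ∈ U :=
  open Classical in decide_eq_true_iff

theorem ofPoint_injective [TotallySeparatedSpace X] :
    Function.Injective (ofPoint : X → LatticeCharacter (Clopens X)) := by
  intro x y h
  by_contra hxy
  obtain ⟨U, hU, hx, hy⟩ := exists_isClopen_of_totally_separated hxy
  have hxU : (ofPoint x).toFun ⟨U, hU⟩ = true := ofPoint_eq_true.2 hx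
  rw [h, ofPoint_eq_true] at hxU
  exact hy hxU

theorem exists_forall_mem_clopens [CompactSpace X] (ρ : LatticeCharacter (Clopens X)) :
    ∃ x : X, ∀ U : Clopens X, ρ.toFun U = true → x ∈ U := by
  let I := {U : Clopens X // ρ.toFun U = true}
  have : Nonempty I := ⟨⟨⊤, ρ.map_top ⊤ isTop_top⟩⟩
  have hdir : Directed (· ⊇ ·) fun U : I => (U.1 : Set X) := fun U V =>
    ⟨⟨U.1 ⊓ V.1, by rw [ρ.map_inf _ _ _ isGLB_pair, U.2, V.2]; rfl⟩,
      Set.inter_subset_left, Set.inter_subset_right⟩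
  have hne : ∀ U : I, (U.1 : Set X).Nonempty := by
    rintro ⟨U, hU⟩
    by_contra h
    obtain rfl : U = ⊥ := SetLike.coe_injective (Set.not_nonempty_iff_eq_empty.1 h)
    rw [ρ.map_bot ⊥ isBot_bot] at hU
    exact Bool.false_ne_true hU
  obtain ⟨x, hx⟩ := IsCompact.nonempty_iInter_of_directed_nonempty_isCompact_isClosed _ hdir hne
    (fun U => U.1.isClopen.isClosed.isCompact) fun U => U.1.isClopen.isClosed
  exact ⟨x, fun U hU => Set.mem_iInter.1 hx ⟨U, hU⟩⟩

theorem ofPoint_surjective [CompactSpace X] :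
    Function.Surjective (ofPoint : X → LatticeCharacter (Clopens X)) := by
  intro ρ
  obtain ⟨x, hx⟩ := exists_forall_mem_clopens ρ
  refine ⟨x, LatticeCharacter.ext (funext fun U => ?_)⟩
  rw [Bool.eq_iff_iff, ofPoint_eq_true]
  refine ⟨fun hxU => ?_, hx U⟩
  by_contra hU
  exact hx Uᶜ (by rw [toFun_compl, Bool.eq_false_of_not_eq_true hU]; rfl) hxU

theorem isInducing_ofPoint [CompactSpace X] [T2Space X] [TotallyDisconnectedSpace X] :
    Topology.IsInducing (ofPoint : X → LatticeCharacter (Clopens X)) := by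
  refine ⟨isTopologicalBasis_isClopen.eq_generateFrom.trans ?_⟩
  have hpre : ∀ V : Clopens X, ofPoint ⁻¹' {ρ | ρ.toFun V = true} = (V : Set X) :=
    fun V => Set.ext fun x => ofPoint_eq_true
  rw [instTopologicalSpaceLatticeCharacter, induced_generateFrom_eq, ← Set.range_comp,
    Function.comp_def]
  simp only [hpre]
  congr 1
  exact Set.ext fun U => ⟨fun hU => ⟨⟨U, hU⟩, rfl⟩, fun ⟨V, hV⟩ => hV ▸ V.isClopen⟩

variable (X) in
/-- Stone duality: a Stone space is the character space of its clopen algebra. -/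
noncomputable def homeomorphClopens [CompactSpace X] [T2Space X] [TotallySeparatedSpace X] :
    X ≃ₜ LatticeCharacter (Clopens X) :=
  (Equiv.ofBijective ofPoint ⟨ofPoint_injective, ofPoint_surjective⟩).toHomeomorphOfIsInducing
    isInducing_ofPoint

end StoneDuality

end LatticeCharacter

theorem IsHyperstonean.latticeCharacter {X L : Type u} [TopologicalSpace X] [PartialOrder L]
    (h : IsHyperstonean X) (φ : L ≃o Clopens X) : IsHyperstonean (LatticeCharacter L) := by
  have := h.compact
  have := h.t2
  have := h.extremallyDisconnected
  exact h.of_homeomorph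
    ((LatticeCharacter.homeomorphClopens X).trans (LatticeCharacter.homeomorphOfOrderIso φ.symm))

open InverseMonoid in
theorem InverseMonoid.MunnQuotient.isCartan {S X : Type u} [InverseMonoid S] [TopologicalSpace X]
    (hX : IsHyperstonean X) (φ : Idem S ≃o Clopens X) {z : S} (hz : IsZeroElem z)
    (hG : HasOrthogonalGluing S) : IsCartan (MunnQuotient S) := by
  let ψ : Idem (MunnQuotient S) ≃o Clopens X := (idemIso S).symm.trans φ
  have hB : IsBooleanAlgebra (Idem (MunnQuotient S)) := ⟨Clopens X, inferInstance, ⟨ψ⟩⟩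
  have hC : ∀ E : Set (Idem (MunnQuotient S)), ∃ e, IsLUB E e := fun E => by
    have := hX.extremallyDisconnected
    obtain ⟨U, hU⟩ := exists_isLUB_clopens (ψ '' E)
    exact ⟨ψ.symm U, ψ.isLUB_image.1 hU⟩
  exact
    { fundamental := isFundamental S
      completeBoolean := (isFundamental S).isCompleteBoolean ⟨_, isZeroElem_mk hz⟩ hB hC
        (hasOrthogonalGluing hz hG)
      hyperstonean := hX.latticeCharacter ψ }

/-- `q` is the projection onto the range of the family `E`, that is, the left support of `E`,
described through multiplication only: `q` fixes `E` from the left, and the left annihilator of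
`E` annihilates `q`. -/
structure IsRangeProjection {R : Type u} [Ring R] [StarRing R] (E : Set R) (q : R) : Prop where
  isStarProjection : IsStarProjection q
  mul_eq : ∀ a ∈ E, q * a = a
  mul_eq_zero : ∀ x, (∀ a ∈ E, x * a = 0) → x * q = 0

section GelfandSpectrum

open WeakDual

variable {A : Type u} [CommCStarAlgebra A]

theorem eq_of_forall_character_eq {a b : A} (h : ∀ φ : characterSpace ℂ A, φ a = φ b) : a = b :=
  (gelfandStarTransform A).injective (ContinuousMap.ext h)

theorem continuous_character_apply (a : A) : Continuous fun φ : characterSpace ℂ A => φ a :=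
  (gelfandStarTransform A a).continuous

variable (A) in
/-- The element of a commutative C⋆-algebra with a given real-valued Gelfand transform. -/
noncomputable def realGelfandSymm : C(characterSpace ℂ A, ℝ) →ₐ[ℝ] A :=
  ((gelfandStarTransform A).symm.toAlgEquiv.toAlgHom.restrictScalars ℝ).comp
    (Complex.ofRealAm.compLeftContinuous ℝ Complex.continuous_ofReal)

theorem character_realGelfandSymm (φ : characterSpace ℂ A) (f : C(characterSpace ℂ A, ℝ)) :
    φ (realGelfandSymm A f) = f φ :=
  congrArg (fun g : C(characterSpace ℂ A, ℂ) => g φ) ((gelfandStarTransform A).apply_symm_apply _)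

theorem star_realGelfandSymm (f : C(characterSpace ℂ A, ℝ)) :
    star (realGelfandSymm A f) = realGelfandSymm A f :=
  eq_of_forall_character_eq fun φ => by
    rw [map_star, character_realGelfandSymm, Complex.star_def, Complex.conj_ofReal]

theorem exists_realGelfandSymm_eq {a : A} (ha : star a = a) : ∃ f, realGelfandSymm A f = a := by
  refine ⟨⟨fun φ => (φ a).re, Complex.continuous_re.comp (continuous_character_apply a)⟩,
    eq_of_forall_character_eq fun φ => ?_⟩
  rw [character_realGelfandSymm]
  refine Complex.conj_eq_iff_re.1 ?_
  rw [← Complex.star_def, ← map_star, ha]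

theorem character_idempotent (φ : characterSpace ℂ A) {a : A} (ha : IsIdempotentElem a) :
    φ a = 0 ∨ φ a = 1 :=
  IsIdempotentElem.iff_eq_zero_or_one.1 (ha.map φ)

theorem isClopen_character_eq_one {a : A} (ha : IsIdempotentElem a) :
    IsClopen {φ : characterSpace ℂ A | φ a = 1} := by
  refine ⟨isClosed_eq (continuous_character_apply a) continuous_const, ?_⟩
  have hne : {φ : characterSpace ℂ A | φ a = 1} = {φ | φ a ≠ 0} := Set.ext fun φ => by
    rcases character_idempotent φ ha with h | h <;> simp [h]
  exact hne ▸ isOpen_ne_fun (continuous_character_apply a) continuous_const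

theorem exists_idempotent_character_eq_one (U : Clopens (characterSpace ℂ A)) :
    ∃ a : A, IsIdempotentElem a ∧ ∀ φ : characterSpace ℂ A, φ a = 1 ↔ φ ∈ U := by
  let χ : C(characterSpace ℂ A, ℝ) := (LocallyConstant.charFn ℝ U.isClopen).toContinuousMap
  have hχ : IsIdempotentElem χ := ContinuousMap.ext fun φ => by
    by_cases hφ : φ ∈ U <;> simp [χ, LocallyConstant.coe_charFn, hφ]
  refine ⟨realGelfandSymm A χ, hχ.map (realGelfandSymm A), fun φ => ?_⟩
  rw [character_realGelfandSymm, Complex.ofReal_eq_one]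
  exact LocallyConstant.charFn_eq_one (Y := ℝ) φ U.isClopen

variable (A) in
/-- An idempotent of a commutative C⋆-algebra corresponds to the support of its Gelfand
transform. -/
noncomputable def idempotentIsoClopens :
    {a : A // IsIdempotentElem a} ≃o Clopens (characterSpace ℂ A) :=
  RelIso.ofSurjective
    (OrderEmbedding.ofMapLEIff
      (fun a => (⟨{φ | φ a.1 = 1}, isClopen_character_eq_one a.2⟩ : Clopens (characterSpace ℂ A)))
      fun a b => by
        constructor
        · refine fun h => (eq_of_forall_character_eq fun φ => ?_ : a.1 * b.1 = a.1)
          rw [map_mul]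
          rcases character_idempotent φ a.2 with ha | ha
          · rw [ha, zero_mul]
          · rw [show φ b.1 = 1 from h ha, mul_one]
        · intro h φ (ha : φ a.1 = 1)
          have hab : φ a.1 * φ b.1 = φ a.1 := by rw [← map_mul]; exact congrArg φ h
          rwa [ha, one_mul] at hab)
    fun U => let ⟨a, ha, haU⟩ := exists_idempotent_character_eq_one U
      ⟨⟨a, ha⟩, SetLike.ext haU⟩

theorem exists_character_eq_one_of_isOpen {U : Set (characterSpace ℂ A)} (hU : IsOpen U)
    {φ : characterSpace ℂ A} (hφ : φ ∈ U) : ∃ b : A, φ b = 1 ∧ ∀ ψ ∉ U, ψ b = 0 := by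
  obtain ⟨f, hf0, hf1, -⟩ := exists_continuous_zero_one_of_isClosed hU.isClosed_compl
    (isClosed_singleton (x := φ)) (Set.disjoint_singleton_right.2 fun h => h hφ)
  refine ⟨realGelfandSymm A f, ?_, fun ψ hψ => ?_⟩
  · rw [character_realGelfandSymm, hf1 rfl, Pi.one_apply, Complex.ofReal_one]
  · rw [character_realGelfandSymm, hf0 hψ, Pi.zero_apply, Complex.ofReal_zero]

theorem IsRangeProjection.closure_eq {U : Set (characterSpace ℂ A)} (hU : IsOpen U) {q : A}
    (hq : IsRangeProjection {a : A | ∀ ψ : characterSpace ℂ A, ψ ∉ U → ψ a = 0} q) :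
    closure U = {φ | φ q = 1} := by
  have hclosed := (isClopen_character_eq_one hq.isStarProjection.isIdempotentElem).isClosed
  refine (closure_minimal (fun φ hφ => ?_) hclosed).antisymm fun φ hφ => ?_
  · obtain ⟨b, hb1, hb0⟩ := exists_character_eq_one_of_isOpen hU hφ
    have hqb := congrArg φ (hq.mul_eq b hb0)
    rwa [map_mul, hb1, mul_one] at hqb
  · by_contra hcl
    obtain ⟨b, hb1, hb0⟩ := exists_character_eq_one_of_isOpen isClosed_closure.isOpen_compl hcl
    have hbq : b * q = 0 := hq.mul_eq_zero b fun a ha => eq_of_forall_character_eq fun ψ => by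
      rw [map_mul, map_zero]
      by_cases hψ : ψ ∈ U
      · rw [hb0 ψ fun h => h (subset_closure hψ), zero_mul]
      · rw [ha ψ hψ, mul_zero]
    have hφbq := congrArg φ hbq
    rw [map_mul, hb1, one_mul, map_zero, show φ q = 1 from hφ] at hφbq
    exact one_ne_zero hφbq

theorem extremallyDisconnected_characterSpace
    (h : ∀ E : Set A, ∃ q, IsRangeProjection E q) :
    ExtremallyDisconnected (characterSpace ℂ A) where
  open_closure U hU := by
    obtain ⟨q, hq⟩ := h {a | ∀ ψ : characterSpace ℂ A, ψ ∉ U → ψ a = 0}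
    rw [hq.closure_eq hU]
    exact (isClopen_character_eq_one hq.isStarProjection.isIdempotentElem).isOpen

end GelfandSpectrum

section WeakOperatorTopology

open Filter Topology ContinuousLinearMapWOT
open scoped ComplexOrder

variable {H : Type u} [NormedAddCommGroup H] [InnerProductSpace ℂ H]

theorem reApplyInnerSelf_mono {S T : H →L[ℂ] H} (h : S ≤ T) (ξ : H) :
    S.reApplyInnerSelf ξ ≤ T.reApplyInnerSelf ξ := by
  have hpos := h.re_inner_nonneg_left ξ
  rwa [_root_.sub_apply, inner_sub_left, map_sub, sub_nonneg] at hpos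

theorem le_iff_forall_inner_le {S T : H →L[ℂ] H} :
    S ≤ T ↔ ∀ ξ, (inner ℂ ξ (S ξ) : ℂ) ≤ inner ℂ ξ (T ξ) := by
  simp only [← sub_nonneg (a := (inner ℂ _ (T _) : ℂ)), ← inner_sub_right]
  refine ⟨fun h ξ => h.inner_nonneg_right ξ, fun h => ?_⟩
  refine (ContinuousLinearMap.isPositive_iff_complex (T - S)).2 fun ξ => ?_
  have hξ : (0 : ℂ) ≤ inner ℂ ((T - S) ξ) ξ := by
    rw [← inner_conj_symm]
    exact star_nonneg_iff.2 (h ξ)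
  exact ⟨RCLike.conj_eq_iff_re.1 (RCLike.conj_eq_iff_im.2 (RCLike.nonneg_iff.1 hξ).2),
    (RCLike.nonneg_iff.1 hξ).1⟩

variable [CompleteSpace H]

theorem continuous_inner_wot (x y : H) :
    Continuous fun T : H →WOT[ℂ] H => (inner ℂ x (T y) : ℂ) :=
  continuous_iff.1 continuous_id y x

theorem continuous_reApplyInnerSelf_wot (ξ : H) :
    Continuous fun T : H →WOT[ℂ] H => T.toCLM.reApplyInnerSelf ξ := by
  simp only [ContinuousLinearMap.reApplyInnerSelf_apply, inner_re_symm]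
  exact RCLike.continuous_re.comp (continuous_inner_wot ξ ξ)

theorem exists_inner_eq_of_norm_le {B : H → H → ℂ} {C : ℝ} (hB : ∀ x y, ‖B x y‖ ≤ C * ‖x‖ * ‖y‖)
    (add_left : ∀ x x' y, B (x + x') y = B x y + B x' y)
    (smul_left : ∀ (c : ℂ) x y, B (c • x) y = starRingEnd ℂ c * B x y)
    (add_right : ∀ x y y', B x (y + y') = B x y + B x y')
    (smul_right : ∀ (c : ℂ) x y, B x (c • y) = c * B x y) :
    ∃ T : H →L[ℂ] H, ∀ x y, inner ℂ x (T y) = B x y :=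
  ⟨star (InnerProductSpace.continuousLinearMapOfBilin (LinearMap.mkContinuous₂
      (LinearMap.mk₂'ₛₗ (starRingEnd ℂ) (RingHom.id ℂ) B add_left smul_left add_right smul_right)
      C hB)), fun x y => by
    rw [ContinuousLinearMap.star_eq_adjoint, ContinuousLinearMap.adjoint_inner_right,
      InnerProductSpace.continuousLinearMapOfBilin_apply]
    rfl⟩

theorem isCompact_norm_le_wot (C : ℝ) : IsCompact {T : H →WOT[ℂ] H | ‖T.toCLM‖ ≤ C} := by
  refine isCompact_iff_ultrafilter_le_nhds.2 fun U hU => ?_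
  have hU : ∀ᶠ T : H →WOT[ℂ] H in U, ‖T.toCLM‖ ≤ C := le_principal_iff.1 hU
  have hC : 0 ≤ C := let ⟨T, hT⟩ := hU.exists; (norm_nonneg _).trans hT
  have hbound : ∀ x y : H, ∀ᶠ T : H →WOT[ℂ] H in U, ‖(inner ℂ x (T y) : ℂ)‖ ≤ C * ‖x‖ * ‖y‖ :=
    fun x y => hU.mono fun T hT => by
      calc ‖(inner ℂ x (T y) : ℂ)‖ ≤ ‖x‖ * ‖T.toCLM y‖ := norm_inner_le_norm _ _
        _ ≤ ‖x‖ * (C * ‖y‖) := by gcongr; exact T.toCLM.le_of_opNorm_le hT y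
        _ = C * ‖x‖ * ‖y‖ := by ring
  have hlim : ∀ x y : H, ∃ l : ℂ, Tendsto (fun T : H →WOT[ℂ] H => (inner ℂ x (T y) : ℂ)) U (𝓝 l) :=
    fun x y => by
      obtain ⟨l, -, hl⟩ := (isCompact_closedBall (0 : ℂ) (C * ‖x‖ * ‖y‖)).ultrafilter_le_nhds'
        (U.map fun T => (inner ℂ x (T y) : ℂ))
        ((hbound x y).mono fun T hT => mem_closedBall_zero_iff.2 hT)
      exact ⟨l, hl⟩
  choose B hB using hlim
  have hB_le : ∀ x y, ‖B x y‖ ≤ C * ‖x‖ * ‖y‖ := fun x y => le_of_tendsto (hB x y).norm (hbound x y)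
  obtain ⟨L, hL⟩ := exists_inner_eq_of_norm_le hB_le
    (fun x x' y => tendsto_nhds_unique (hB (x + x') y) (by
      simpa only [inner_add_left] using (hB x y).add (hB x' y)))
    (fun c x y => tendsto_nhds_unique (hB (c • x) y) (by
      simpa only [inner_smul_left] using (hB x y).const_mul (starRingEnd ℂ c)))
    (fun x y y' => tendsto_nhds_unique (hB x (y + y')) (by
      simpa only [map_add, inner_add_right] using (hB x y).add (hB x y')))
    (fun c x y => tendsto_nhds_unique (hB x (c • y)) (by
      simpa only [map_smul, inner_smul_right] using (hB x y).const_mul c))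
  refine ⟨ofCLM L, ContinuousLinearMap.opNorm_le_of_re_inner_le hC fun y x hy hx => ?_, ?_⟩
  · calc RCLike.re (inner ℂ (L y) x) ≤ ‖(inner ℂ x (L y) : ℂ)‖ := by
          rw [inner_re_symm]; exact RCLike.re_le_norm _
      _ ≤ C := by simpa only [hL, hx, hy, mul_one] using hB_le x y
  · exact le_nhds_iff_forall_inner_apply_le_nhds.2 fun y x => (hL x y).symm ▸ hB x y

theorem isClosed_wot (N : VonNeumannAlgebra H) : IsClosed {T : H →WOT[ℂ] H | T.toCLM ∈ N} := by
  have hN : {T : H →WOT[ℂ] H | T.toCLM ∈ N} = ⋂ y ∈ N.commutant, {T | ofCLM y * T = T * ofCLM y} :=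
    Set.ext fun T => by
      simp only [Set.mem_iInter, Set.mem_ofPred_eq, ← toCLM_injective.eq_iff (b := T * _)]
      conv_lhs => rw [← N.commutant_commutant, VonNeumannAlgebra.mem_commutant_iff]
      rfl
  rw [hN]
  exact isClosed_biInter fun y _ =>
    isClosed_eq (continuous_const_mul (ofCLM y)) (continuous_mul_const (ofCLM y))

instance isClosed_toStarSubalgebra (N : VonNeumannAlgebra H) :
    IsClosed (N.toStarSubalgebra : Set (H →L[ℂ] H)) :=
  (isClosed_wot N).preimage continuous_ofCLM

theorem isClosed_Ici_wot (S : H →L[ℂ] H) : IsClosed {T : H →WOT[ℂ] H | S ≤ T.toCLM} := by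
  simp only [le_iff_forall_inner_le, Set.ofPred_forall]
  exact isClosed_iInter fun ξ => isClosed_le continuous_const (continuous_inner_wot ξ ξ)

theorem isClosed_Iic_wot (S : H →L[ℂ] H) : IsClosed {T : H →WOT[ℂ] H | T.toCLM ≤ S} := by
  simp only [le_iff_forall_inner_le, Set.ofPred_forall]
  exact isClosed_iInter fun ξ => isClosed_le (continuous_inner_wot ξ ξ) continuous_const

end WeakOperatorTopology

section VonNeumannAlgebra

open ContinuousLinearMapWOT

variable {H : Type u} [NormedAddCommGroup H] [InnerProductSpace ℂ H] [CompleteSpace H]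
  {N : VonNeumannAlgebra H}

theorem norm_le_of_mem_Icc {A B T : H →L[ℂ] H} (hT : T ∈ Set.Icc A B) : ‖T‖ ≤ ‖B - A‖ + ‖A‖ :=
  calc ‖T‖ = ‖(T - A) + A‖ := by rw [sub_add_cancel]
    _ ≤ ‖T - A‖ + ‖A‖ := norm_add_le _ _
    _ ≤ ‖B - A‖ + ‖A‖ := by
      gcongr
      exact CStarAlgebra.norm_le_norm_of_nonneg_of_le (sub_nonneg.2 hT.1) (sub_le_sub_right hT.2 A)

/-- Vigier's theorem. -/
theorem exists_mem_isLUB_of_directedOn {F : Set (H →L[ℂ] H)} (hFN : ∀ T ∈ F, T ∈ N)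
    (hne : F.Nonempty) (hdir : DirectedOn (· ≤ ·) F) (hbdd : BddAbove F) :
    ∃ T ∈ N, IsLUB F T ∧
      ∀ ξ, IsLUB ((fun A => A.reApplyInnerSelf ξ) '' F) (T.reApplyInnerSelf ξ) := by
  classical
  obtain ⟨A, hA⟩ := hne
  obtain ⟨B, hB⟩ := hbdd
  let K : Set (H →WOT[ℂ] H) := {T | ‖T.toCLM‖ ≤ ‖B - A‖ + ‖A‖} ∩ {T | T.toCLM ∈ N} ∩
    ((⋂ S ∈ upperBounds F, {T | T.toCLM ≤ S}) ∩
      ⋂ (ξ) (b ∈ upperBounds ((fun A => A.reApplyInnerSelf ξ) '' F)),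
        {T | T.toCLM.reApplyInnerSelf ξ ≤ b})
  have hK : IsCompact K := ((isCompact_norm_le_wot _).inter_right (isClosed_wot N)).inter_right
    ((isClosed_biInter fun S _ => isClosed_Iic_wot S).inter (isClosed_iInter fun ξ =>
      isClosed_biInter fun b _ =>
        isClosed_le (continuous_reApplyInnerSelf_wot ξ) continuous_const))
  have hmem : ∀ T ∈ F, A ≤ T → ofCLM T ∈ K := fun T hT hAT => by
    simp only [K, Set.mem_inter_iff, Set.mem_ofPred_eq, Set.mem_iInter]
    exact ⟨⟨norm_le_of_mem_Icc ⟨hAT, hB hT⟩, hFN T hT⟩, fun S hS => hS hT,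
      fun ξ b hb => hb ⟨T, hT, rfl⟩⟩
  obtain ⟨T, hTK, hT⟩ := hK.inter_iInter_nonempty (fun S : F => {T | S.1 ≤ T.toCLM})
    (fun S => isClosed_Ici_wot S.1) fun s => by
      have : Nonempty F := ⟨⟨A, hA⟩⟩
      obtain ⟨M, hM⟩ := hdir.directed_val.finset_le (insert (⟨A, hA⟩ : F) s)
      exact ⟨ofCLM M.1, hmem M.1 M.2 (hM _ (Finset.mem_insert_self _ _)),
        Set.mem_iInter₂.2 fun S hS => hM S (Finset.mem_insert_of_mem hS)⟩
  simp only [K, Set.mem_inter_iff, Set.mem_ofPred_eq, Set.mem_iInter] at hTK hT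
  obtain ⟨⟨-, hTN⟩, hTle, hTre⟩ := hTK
  refine ⟨T.toCLM, hTN, ⟨fun S hS => hT ⟨S, hS⟩, hTle⟩, fun ξ => ⟨?_, hTre ξ⟩⟩
  rintro _ ⟨S, hS, rfl⟩
  exact reApplyInnerSelf_mono (hT ⟨S, hS⟩) ξ

theorem exists_isRangeProjection (E : Set (H →L[ℂ] H)) :
    ∃ q : H →L[ℂ] H, IsRangeProjection E q := by
  set K : Submodule ℂ H := (Submodule.span ℂ (⋃ a ∈ E, Set.range a)).topologicalClosure
  have : CompleteSpace K := (Submodule.isClosed_topologicalClosure _).completeSpace_coe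
  refine ⟨K.starProjection, isStarProjection_starProjection, fun a ha => ?_, fun x hx => ?_⟩
  · ext ξ
    refine Submodule.starProjection_eq_self_iff.2 (Submodule.le_topologicalClosure _ ?_)
    exact Submodule.subset_span (Set.mem_biUnion ha ⟨ξ, rfl⟩)
  · have hle : K ≤ LinearMap.ker (x : H →ₗ[ℂ] H) := by
      refine Submodule.topologicalClosure_minimal _ (Submodule.span_le.2 ?_) x.isClosed_ker
      rintro _ hη
      obtain ⟨a, ha, ξ, rfl⟩ := Set.mem_iUnion₂.1 hη
      exact DFunLike.congr_fun (hx a ha) ξ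
    ext ξ
    exact hle (K.starProjection_apply_mem ξ)

theorem IsRangeProjection.mem {E : Set (H →L[ℂ] H)} {q : H →L[ℂ] H} (hq : IsRangeProjection E q)
    (hE : ∀ a ∈ E, a ∈ N) : q ∈ N := by
  refine (VonNeumannAlgebra.IsStarProjection.mem_iff hq.isStarProjection N).2 fun y hy => ?_
  rw [ContinuousLinearMap.IsIdempotentElem.range_mem_invtSubmodule_iff
    hq.isStarProjection.isIdempotentElem]
  have hqy : (y - q * y) * q = 0 := hq.mul_eq_zero _ fun a ha => by
    rw [sub_mul, mul_assoc, ← VonNeumannAlgebra.mem_commutant_iff.1 hy a (hE a ha), ← mul_assoc,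
      hq.mul_eq a ha, sub_self]
  rwa [sub_mul, sub_eq_zero, eq_comm, mul_assoc] at hqy

theorem exists_isRangeProjection_toStarSubalgebra (N : VonNeumannAlgebra H)
    (E : Set N.toStarSubalgebra) : ∃ q, IsRangeProjection E q := by
  obtain ⟨q, hq⟩ := exists_isRangeProjection ((↑) '' E : Set (H →L[ℂ] H))
  have hqN : q ∈ N.toStarSubalgebra := hq.mem <| Set.forall_mem_image.2 fun a _ => a.2
  exact ⟨⟨q, hqN⟩,
    ⟨Subtype.ext hq.isStarProjection.isIdempotentElem,
      Subtype.ext hq.isStarProjection.isSelfAdjoint⟩,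
    fun a ha => Subtype.ext (hq.mul_eq a ⟨a, ha, rfl⟩),
    fun x hx => Subtype.ext <| hq.mul_eq_zero x <| Set.forall_mem_image.2 fun a ha =>
      congrArg Subtype.val (hx a ha)⟩

end VonNeumannAlgebra

section OrthogonalSum

theorem star_mul_self_mul_star {R : Type u} [Semigroup R] [StarMul R] {v : R}
    (hv : v * star v * v = v) : star v * v * star v = star v := by
  simpa only [star_mul, star_star, mul_assoc] using congrArg star hv

/-- `v` is the orthogonal sum of the partial isometries `u i`: a partial isometry restricting to
`u i` on the initial space of `u i`, whose initial and final spaces are spanned by those of the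
`u i`. -/
structure IsOrthogonalSum {R : Type u} {ι : Type*} [Ring R] [StarRing R] (u : ι → R) (v : R) :
    Prop where
  mul_star_mul_self : v * star v * v = v
  mul_initial : ∀ i, v * (star (u i) * u i) = u i
  final_mul : ∀ i, u i * star (u i) * v = u i
  initial : IsRangeProjection (Set.range fun i => star (u i) * u i) (star v * v)
  final : IsRangeProjection (Set.range fun i => u i * star (u i)) (v * star v)

variable {R : Type u} {ι : Type*} [Ring R] [StarRing R] {u : ι → R} {v : R}

protected theorem IsOrthogonalSum.star (h : IsOrthogonalSum u v) :
    IsOrthogonalSum (fun i => star (u i)) (star v) where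
  mul_star_mul_self := by rw [star_star, star_mul_self_mul_star h.mul_star_mul_self]
  mul_initial i := by
    simpa only [star_mul, star_star, mul_assoc] using congrArg star (h.final_mul i)
  final_mul i := by
    simpa only [star_mul, star_star, mul_assoc] using congrArg star (h.mul_initial i)
  initial := by simpa only [star_star] using h.final
  final := by simpa only [star_star] using h.initial

theorem IsOrthogonalSum.star_mul_apply (h : IsOrthogonalSum u v) (i : ι) :
    star v * u i = star (u i) * u i :=
  calc star v * u i = star v * v * (star (u i) * u i) := by rw [mul_assoc, h.mul_initial]
    _ = star (u i) * u i := h.initial.mul_eq _ ⟨i, rfl⟩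

theorem IsOrthogonalSum.apply_mul_star_mul_self (h : IsOrthogonalSum u v) (i : ι) :
    u i * star (u i) * u i = u i := by
  have hstar : star (u i) * v = star (u i) * u i := by
    simpa only [star_mul, star_star] using congrArg star (h.star_mul_apply i)
  calc u i * star (u i) * u i = u i * star (u i) * v := by rw [mul_assoc, mul_assoc, hstar]
    _ = u i := h.final_mul i

theorem IsRangeProjection.star_mul_self_eq {q : R}
    (hq : IsRangeProjection (Set.range fun i => star (u i) * u i) q)
    (hu : ∀ i, u i * star (u i) * u i = u i) (hve : ∀ i, v * (star (u i) * u i) = u i)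
    (hfv : ∀ i, u i * star (u i) * v = u i) (hvq : v * q = v) : star v * v = q := by
  have hvu : ∀ i, star v * u i = star (u i) * u i := fun i =>
    calc star v * u i = star (u i * star (u i) * v) * u i := by
          rw [star_mul, star_mul, star_star, mul_assoc, hu]
      _ = star (u i) * u i := by rw [hfv]
  have hann : (star v * v - 1) * q = 0 := hq.mul_eq_zero _ <| Set.forall_mem_range.2 fun i => by
    rw [sub_mul, mul_assoc, hve, hvu, one_mul, sub_self]
  rwa [sub_mul, mul_assoc, hvq, one_mul, sub_eq_zero] at hann

theorem isOrthogonalSum_of_mul_eq {q r : R} (hu : ∀ i, u i * star (u i) * u i = u i)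
    (hq : IsRangeProjection (Set.range fun i => star (u i) * u i) q)
    (hr : IsRangeProjection (Set.range fun i => u i * star (u i)) r)
    (hve : ∀ i, v * (star (u i) * u i) = u i) (hfv : ∀ i, u i * star (u i) * v = u i)
    (hvq : v * q = v) (hrv : r * v = v) : IsOrthogonalSum u v := by
  have hqv : star v * v = q := hq.star_mul_self_eq hu hve hfv hvq
  have hvr : v * star v = r := by
    have hr' : IsRangeProjection (Set.range fun i => star (star (u i)) * star (u i)) r := by
      simpa only [star_star] using hr
    simpa only [star_star] using hr'.star_mul_self_eq (v := star v)
      (fun i => by rw [star_star, star_mul_self_mul_star (hu i)])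
      (fun i => by simpa only [star_mul, star_star, mul_assoc] using congrArg star (hfv i))
      (fun i => by simpa only [star_mul, star_star, mul_assoc] using congrArg star (hve i))
      (by rw [← hr.isStarProjection.isSelfAdjoint.star_eq, ← star_mul, hrv])
  exact ⟨by rw [mul_assoc, hqv, hvq], hve, hfv, hqv ▸ hq, hvr ▸ hr⟩

theorem IsRangeProjection.mul_eq_of_isSelfAdjoint {E : Set R} {q a : R}
    (hq : IsRangeProjection E q) (ha : a ∈ E) (hsa : IsSelfAdjoint a) : a * q = a := by
  simpa only [star_mul, hsa.star_eq, hq.isStarProjection.isSelfAdjoint.star_eq]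
    using congrArg star (hq.mul_eq a ha)

theorem IsRangeProjection.isOrthogonalSum {q r : R} (hu : ∀ i, u i * star (u i) * u i = u i)
    (hq : IsRangeProjection (Set.range fun i => star (u i) * u i) q)
    (hr : IsRangeProjection (Set.range fun i => u i * star (u i)) r)
    (hve : ∀ i, v * (star (u i) * u i) = u i) (hfv : ∀ i, u i * star (u i) * v = u i) :
    IsOrthogonalSum u (r * v * q) := by
  have hqe : ∀ i, q * (star (u i) * u i) = star (u i) * u i := fun i => hq.mul_eq _ ⟨i, rfl⟩
  have heq : ∀ i, star (u i) * u i * q = star (u i) * u i := fun i =>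
    hq.mul_eq_of_isSelfAdjoint ⟨i, rfl⟩ (.star_mul_self _)
  have hrf : ∀ i, r * (u i * star (u i)) = u i * star (u i) := fun i => hr.mul_eq _ ⟨i, rfl⟩
  have hfr : ∀ i, u i * star (u i) * r = u i * star (u i) := fun i =>
    hr.mul_eq_of_isSelfAdjoint ⟨i, rfl⟩ (.mul_star_self _)
  refine isOrthogonalSum_of_mul_eq hu hq hr (fun i => ?_) (fun i => ?_) ?_ ?_
  · rw [mul_assoc, hqe, mul_assoc, hve, ← hu i, ← mul_assoc, hrf]
  · calc u i * star (u i) * (r * v * q) = u i * star (u i) * r * v * q := by simp only [mul_assoc]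
      _ = u i * q := by rw [hfr, hfv]
      _ = u i * (star (u i) * u i * q) := by rw [← mul_assoc, ← mul_assoc, hu]
      _ = u i := by rw [heq, ← mul_assoc, hu]
  · rw [mul_assoc, hq.isStarProjection.isIdempotentElem]
  · rw [mul_assoc, ← mul_assoc r, hr.isStarProjection.isIdempotentElem]

section FiniteSums

variable {s : Finset ι} {j : ι}

theorem sum_mul_initial (hu : ∀ i, u i * star (u i) * u i = u i)
    (h : Pairwise fun i j => u i * star (u j) = 0) (hj : j ∈ s) :
    (∑ i ∈ s, u i) * (star (u j) * u j) = u j := by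
  rw [Finset.sum_mul, Finset.sum_eq_single_of_mem j hj, ← mul_assoc, hu]
  intro i _ hij
  rw [← mul_assoc, h hij, zero_mul]

theorem final_mul_sum (hu : ∀ i, u i * star (u i) * u i = u i)
    (h : Pairwise fun i j => star (u i) * u j = 0) (hj : j ∈ s) :
    u j * star (u j) * ∑ i ∈ s, u i = u j := by
  rw [Finset.mul_sum, Finset.sum_eq_single_of_mem j hj, hu]
  intro i _ hij
  rw [mul_assoc, h hij.symm, mul_zero]

theorem sum_mul_star_mul_sum (hu : ∀ i, u i * star (u i) * u i = u i)
    (hinit : Pairwise fun i j => u i * star (u j) = 0)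
    (hfin : Pairwise fun i j => star (u i) * u j = 0) :
    (∑ i ∈ s, u i) * star (∑ i ∈ s, u i) * ∑ i ∈ s, u i = ∑ i ∈ s, u i := by
  have hstar : star (∑ i ∈ s, u i) * ∑ i ∈ s, u i = ∑ j ∈ s, star (u j) * u j := by
    rw [star_sum, Finset.sum_mul]
    refine Finset.sum_congr rfl fun j hj => ?_
    rw [Finset.mul_sum, Finset.sum_eq_single_of_mem j hj fun i _ hij => hfin hij.symm]
  rw [mul_assoc, hstar, Finset.mul_sum]
  exact Finset.sum_congr rfl fun j hj => sum_mul_initial hu hinit hj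

end FiniteSums

theorem norm_le_one_of_mul_star_mul_self {A : Type u} [NormedRing A] [StarRing A] [CStarRing A]
    {v : A} (hv : v * star v * v = v) : ‖v‖ ≤ 1 := by
  have hp : IsStarProjection (star v * v) :=
    ⟨by rw [IsIdempotentElem, ← mul_assoc, star_mul_self_mul_star hv], .star_mul_self v⟩
  have hnorm := hp.norm_le
  rw [CStarRing.norm_star_mul_self] at hnorm
  exact abs_le_one_iff_mul_self_le_one.2 hnorm |>.trans' (le_abs_self _)

end OrthogonalSum

section OrthogonalSumOfOperators

open ContinuousLinearMapWOT

variable {H : Type u} {ι : Type*} [NormedAddCommGroup H] [InnerProductSpace ℂ H] [CompleteSpace H]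
  {N : VonNeumannAlgebra H} {u : ι → H →L[ℂ] H} {v : H →L[ℂ] H}

/-- A weak operator limit point of the finite partial sums. -/
theorem exists_mul_initial_eq_and_final_mul_eq (hN : ∀ i, u i ∈ N)
    (hu : ∀ i, u i * star (u i) * u i = u i)
    (hinit : Pairwise fun i j => u i * star (u j) = 0)
    (hfin : Pairwise fun i j => star (u i) * u j = 0) :
    ∃ v ∈ N, (∀ i, v * (star (u i) * u i) = u i) ∧ ∀ i, u i * star (u i) * v = u i := by
  have hK : IsCompact ({T : H →WOT[ℂ] H | ‖T.toCLM‖ ≤ 1} ∩ {T | T.toCLM ∈ N}) :=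
    (isCompact_norm_le_wot 1).inter_right (isClosed_wot N)
  have hclosed : ∀ i, IsClosed {T : H →WOT[ℂ] H | T * ofCLM (star (u i) * u i) = ofCLM (u i) ∧
      ofCLM (u i * star (u i)) * T = ofCLM (u i)} := fun i =>
    (isClosed_eq (continuous_mul_const _) continuous_const).inter
      (isClosed_eq (continuous_const_mul _) continuous_const)
  obtain ⟨T, ⟨-, hTN⟩, hT⟩ := hK.inter_iInter_nonempty _ hclosed fun s =>
    ⟨ofCLM (∑ i ∈ s, u i),
      ⟨norm_le_one_of_mul_star_mul_self (sum_mul_star_mul_sum hu hinit hfin),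
        sum_mem (S := N.toStarSubalgebra) fun i _ => hN i⟩,
      Set.mem_iInter₂.2 fun j hj => ⟨congrArg ofCLM (sum_mul_initial hu hinit hj),
        congrArg ofCLM (final_mul_sum hu hfin hj)⟩⟩
  rw [Set.mem_iInter] at hT
  exact ⟨T.toCLM, hTN, fun i => congrArg toCLM (hT i).1, fun i => congrArg toCLM (hT i).2⟩

theorem exists_isOrthogonalSum (hN : ∀ i, u i ∈ N) (hu : ∀ i, u i * star (u i) * u i = u i)
    (hinit : Pairwise fun i j => u i * star (u j) = 0)
    (hfin : Pairwise fun i j => star (u i) * u j = 0) : ∃ v ∈ N, IsOrthogonalSum u v := by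
  obtain ⟨v, hv, hve, hfv⟩ := exists_mul_initial_eq_and_final_mul_eq hN hu hinit hfin
  obtain ⟨q, hq⟩ := exists_isRangeProjection (Set.range fun i => star (u i) * u i)
  obtain ⟨r, hr⟩ := exists_isRangeProjection (Set.range fun i => u i * star (u i))
  have hqN : q ∈ N := hq.mem <| Set.forall_mem_range.2 fun i => mul_mem (star_mem (hN i)) (hN i)
  have hrN : r ∈ N := hr.mem <| Set.forall_mem_range.2 fun i => mul_mem (hN i) (star_mem (hN i))
  exact ⟨r * v * q, mul_mem (mul_mem hrN hv) hqN, hq.isOrthogonalSum hu hr hve hfv⟩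

theorem IsOrthogonalSum.conj_mul_final (hv : IsOrthogonalSum u v) {d : H →L[ℂ] H} {i : ι}
    (hd : Commute d (star (u i) * u i)) :
    v * d * star v * (u i * star (u i)) = u i * d * star (u i) :=
  calc v * d * star v * (u i * star (u i))
    _ = v * d * star (u i * star (u i) * v) := by
      rw [star_mul, star_mul, star_star, mul_assoc]
    _ = v * d * (star (u i) * u i * star (u i)) := by
      rw [hv.final_mul, star_mul_self_mul_star (hv.apply_mul_star_mul_self i)]
    _ = v * (d * (star (u i) * u i)) * star (u i) := by simp only [mul_assoc]
    _ = u i * d * star (u i) := by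
      rw [hd.eq, ← mul_assoc v, hv.mul_initial]

theorem IsOrthogonalSum.conj_mem (hv : IsOrthogonalSum u v) {d : H →L[ℂ] H}
    (hd : ∀ i, Commute d (star (u i) * u i)) (hfinal : ∀ i, u i * star (u i) ∈ N)
    (hconj : ∀ i, u i * d * star (u i) ∈ N) : v * d * star v ∈ N := by
  rw [← N.commutant_commutant, VonNeumannAlgebra.mem_commutant_iff]
  intro y hy
  have hy : ∀ a ∈ N, a * y = y * a := VonNeumannAlgebra.mem_commutant_iff.1 hy
  have hr : v * star v ∈ N := hv.final.mem <| Set.forall_mem_range.2 hfinal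
  have hxr : v * d * star v * (v * star v) = v * d * star v := by
    rw [mul_assoc, ← mul_assoc (star v), star_mul_self_mul_star hv.mul_star_mul_self]
  have hcomm : (y * (v * d * star v) - v * d * star v * y) * (v * star v) = 0 :=
    hv.final.mul_eq_zero _ <| Set.forall_mem_range.2 fun i => by
      rw [sub_mul, mul_assoc y, hv.conj_mul_final (hd i), mul_assoc _ y, ← hy _ (hfinal i),
        ← mul_assoc _ _ y, hv.conj_mul_final (hd i), hy _ (hconj i), sub_self]
  rwa [sub_mul, mul_assoc y, mul_assoc _ y, ← hy _ hr, ← mul_assoc _ _ y, hxr, sub_eq_zero] at hcomm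

end OrthogonalSumOfOperators

section SpectrumOfVonNeumannAlgebra

variable {H : Type u} [NormedAddCommGroup H] [InnerProductSpace ℂ H] [CompleteSpace H]
  (D : VonNeumannAlgebra H) [IsMulCommutative D.toStarSubalgebra]

noncomputable instance : CommCStarAlgebra D.toStarSubalgebra where
  __ := StarSubalgebra.cstarAlgebra D.toStarSubalgebra
  mul_comm := mul_comm'

/-- The Gelfand spectrum of an abelian von Neumann algebra. -/
abbrev gelfandSpectrum : Type u := WeakDual.characterSpace ℂ D.toStarSubalgebra

variable {D}

/-- The operator in `D` with a given real-valued Gelfand transform. -/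
noncomputable def gelfandOperator : C(gelfandSpectrum D, ℝ) →ₐ[ℝ] H →L[ℂ] H :=
  (D.toStarSubalgebra.subtype.toAlgHom.restrictScalars ℝ).comp (realGelfandSymm D.toStarSubalgebra)

variable {f g : C(gelfandSpectrum D, ℝ)}

theorem gelfandOperator_mem (f : C(gelfandSpectrum D, ℝ)) : gelfandOperator f ∈ D :=
  (realGelfandSymm D.toStarSubalgebra f).2

theorem isSelfAdjoint_gelfandOperator (f : C(gelfandSpectrum D, ℝ)) :
    IsSelfAdjoint (gelfandOperator f) :=
  congrArg Subtype.val (star_realGelfandSymm f)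

theorem exists_gelfandOperator_eq {T : H →L[ℂ] H} (hT : T ∈ D) (hs : IsSelfAdjoint T) :
    ∃ f : C(gelfandSpectrum D, ℝ), gelfandOperator f = T :=
  let ⟨f, hf⟩ := exists_realGelfandSymm_eq (a := (⟨T, hT⟩ : D.toStarSubalgebra)) (Subtype.ext hs)
  ⟨f, congrArg Subtype.val hf⟩

theorem gelfandOperator_nonneg_iff : 0 ≤ gelfandOperator f ↔ 0 ≤ f := by
  constructor
  · intro h φ
    have hmem : φ (realGelfandSymm D.toStarSubalgebra f) ∈ spectrum ℂ (gelfandOperator f) :=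
      StarSubalgebra.spectrum_eq D.toStarSubalgebra ▸ AlgHom.apply_mem_spectrum φ _
    rw [character_realGelfandSymm] at hmem
    open scoped ComplexOrder in exact Complex.zero_le_real.1 (spectrum_nonneg_of_nonneg h hmem)
  · intro h
    let g : C(gelfandSpectrum D, ℝ) := ⟨fun φ => √(f φ), by fun_prop⟩
    have hg : f = g * g := ContinuousMap.ext fun φ => (Real.mul_self_sqrt (h φ)).symm
    rw [hg, map_mul]
    exact (isSelfAdjoint_gelfandOperator g).mul_self_nonneg

theorem gelfandOperator_le_iff : gelfandOperator f ≤ gelfandOperator g ↔ f ≤ g := by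
  rw [← sub_nonneg, ← sub_nonneg (a := g), ← map_sub, gelfandOperator_nonneg_iff]

/-- The functional `f ↦ ⟪ξ, f ξ⟫` of a vector `ξ`, where `f` acts as the operator with Gelfand
transform `f`. -/
noncomputable def vectorFunctional (ξ : H) : C(gelfandSpectrum D, ℝ) →ₗ[ℝ] ℝ where
  toFun f := (gelfandOperator f).reApplyInnerSelf ξ
  map_add' f g := by
    simp only [ContinuousLinearMap.reApplyInnerSelf_apply, map_add, add_apply, inner_add_left]
  map_smul' c f := by
    simp only [ContinuousLinearMap.reApplyInnerSelf_apply, map_smul, smul_apply,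
      inner_smul_left_eq_smul, RCLike.smul_re, smul_eq_mul, RingHom.id_apply]

theorem forall_vectorFunctional_nonneg_iff : (∀ ξ, 0 ≤ vectorFunctional ξ f) ↔ 0 ≤ f := by
  rw [← gelfandOperator_nonneg_iff, ContinuousLinearMap.nonneg_iff_isPositive,
    ContinuousLinearMap.isPositive_def', and_iff_right (isSelfAdjoint_gelfandOperator f)]
  rfl

theorem isLUB_vectorFunctional (ξ : H) {F : Set C(gelfandSpectrum D, ℝ)} (hne : F.Nonempty)
    (hdir : DirectedOn (· ≤ ·) F) (hf : IsLUB F f) :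
    IsLUB (vectorFunctional ξ '' F) (vectorFunctional ξ f) := by
  let ρ : C(gelfandSpectrum D, ℝ) ↪o (H →L[ℂ] H) :=
    OrderEmbedding.ofMapLEIff gelfandOperator fun _ _ => gelfandOperator_le_iff
  have hdir' : DirectedOn (· ≤ ·) (ρ '' F) :=
    directedOn_image.2 (hdir.mono fun _ _ h => gelfandOperator_le_iff.2 h)
  obtain ⟨T, hTD, hT, hTξ⟩ := exists_mem_isLUB_of_directedOn
    (Set.forall_mem_image.2 fun g _ => gelfandOperator_mem g) (hne.image ρ) hdir'
    (ρ.monotone.map_bddAbove ⟨f, hf.1⟩)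
  obtain ⟨g, hg⟩ := hne
  have hTs : IsSelfAdjoint T := by
    have hgT : 0 ≤ T - gelfandOperator g := sub_nonneg.2 (hT.1 ⟨g, hg, rfl⟩)
    simpa only [sub_add_cancel] using
      (IsSelfAdjoint.of_nonneg hgT).add (isSelfAdjoint_gelfandOperator g)
  obtain ⟨k, rfl⟩ := exists_gelfandOperator_eq hTD hTs
  obtain rfl : k = f := (IsLUB.of_image (f := ρ) ρ.le_iff_le hT).unique hf
  have hξ := hTξ ξ
  rw [Set.image_image] at hξ
  exact hξ

theorem exists_isNormalMeasure_vectorFunctional [MeasurableSpace (gelfandSpectrum D)]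
    [BorelSpace (gelfandSpectrum D)] (ξ : H) :
    ∃ μ : Measure (gelfandSpectrum D), IsNormalMeasure μ ∧
      ∀ f : C(gelfandSpectrum D, ℝ), ∫ φ, f φ ∂μ = vectorFunctional ξ f := by
  let Λ : CompactlySupportedContinuousMap (gelfandSpectrum D) ℝ →ₚ[ℝ] ℝ :=
    PositiveLinearMap.mk₀
      { toFun := fun f => vectorFunctional ξ f.toContinuousMap
        map_add' := fun f g => (vectorFunctional ξ).map_add _ _
        map_smul' := fun c f => (vectorFunctional ξ).map_smul c _ }
      fun f hf => forall_vectorFunctional_nonneg_iff.2 hf ξ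
  have hΛ : ∀ f : C(gelfandSpectrum D, ℝ),
      ∫ φ, f φ ∂(RealRMK.rieszMeasure Λ) = vectorFunctional ξ f := fun f =>
    RealRMK.integral_rieszMeasure Λ (CompactlySupportedContinuousMap.continuousMapEquiv f)
  refine ⟨RealRMK.rieszMeasure Λ, ⟨inferInstance, inferInstance, fun F f hne hdir hf => ?_⟩, hΛ⟩
  simpa only [hΛ] using isLUB_vectorFunctional ξ hne hdir hf

variable (D) in
theorem isHyperstonean_gelfandSpectrum : IsHyperstonean (gelfandSpectrum D) where
  compact := inferInstance
  t2 := inferInstance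
  extremallyDisconnected :=
    extremallyDisconnected_characterSpace (exists_isRangeProjection_toStarSubalgebra D)
  exists_normal f hf hf0 := by
    obtain ⟨ξ, hξ⟩ : ∃ ξ : H, 0 < vectorFunctional ξ f := by
      by_contra! h
      have hneg : 0 ≤ -f := forall_vectorFunctional_nonneg_iff.1 fun ξ => by
        rw [map_neg]
        exact neg_nonneg.2 (h ξ)
      exact hf0 (le_antisymm (neg_nonneg.1 hneg) hf)
    let _ : MeasurableSpace (gelfandSpectrum D) := borel _
    have _ : BorelSpace (gelfandSpectrum D) := ⟨rfl⟩
    obtain ⟨μ, hμ, hint⟩ := exists_isNormalMeasure_vectorFunctional (D := D) ξ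
    exact ⟨μ, hμ, hξ.trans_eq (hint f).symm⟩

end SpectrumOfVonNeumannAlgebra

section PartialIsometry

variable {R : Type u} [Semigroup R] [StarMul R] {v w : R}

theorem mul_mul_star_mul_mul (hv : v * star v * v = v) (hw : w * star w * w = w)
    (h : Commute (star v * v) (w * star w)) : v * w * star (v * w) * (v * w) = v * w :=
  calc v * w * star (v * w) * (v * w) = v * ((w * star w) * (star v * v)) * w := by
        rw [star_mul]; simp only [mul_assoc]
    _ = (v * star v * v) * (w * star w * w) := by rw [← h.eq]; simp only [mul_assoc]
    _ = v * w := by rw [hv, hw]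

theorem isSelfAdjoint_of_isIdempotentElem (hv : v * star v * v = v) (hi : IsIdempotentElem v)
    (h : Commute (star v * v) (v * star v)) : IsSelfAdjoint v :=
  calc star v = star v * v * (v * star v) := by
        rw [mul_assoc, ← mul_assoc v, hi.eq, ← mul_assoc, star_mul_self_mul_star hv]
    _ = v * star v * (star v * v) := h.eq
    _ = v := by rw [mul_assoc, ← mul_assoc (star v), hi.star.eq, ← mul_assoc, hv]

end PartialIsometry

section AbelianInclusion

variable {H : Type u} [NormedAddCommGroup H] [InnerProductSpace ℂ H] [CompleteSpace H]

variable (H) in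
/-- An inclusion `D ⊆ M` of von Neumann algebras with `D` abelian, but not necessarily maximal
abelian in `M`. -/
structure AbelianInclusion where
  M : VonNeumannAlgebra H
  D : VonNeumannAlgebra H
  D_le : D.toStarSubalgebra ≤ M.toStarSubalgebra
  isMulCommutative : IsMulCommutative D.toStarSubalgebra

namespace AbelianInclusion

attribute [instance] AbelianInclusion.isMulCommutative

variable (A : AbelianInclusion H)

/-- The set of groupoid normalizers of `D` in `M`. -/
def normalizers : Set (H →L[ℂ] H) := groupoidNormalizers A.M A.D.toStarSubalgebra

variable {A} {v w d : H →L[ℂ] H}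

theorem commute (hv : v ∈ A.D) (hw : w ∈ A.D) : Commute v w :=
  congrArg Subtype.val (mul_comm' (⟨v, hv⟩ : A.D.toStarSubalgebra) ⟨w, hw⟩)

theorem mul_star_self_mem (hv : v ∈ A.normalizers) : v * star v ∈ A.D := by
  have h : v * 1 * star v ∈ A.D := (hv.2.2 1 (one_mem _)).1
  rwa [mul_one] at h

theorem star_mem_normalizers (hv : v ∈ A.normalizers) : star v ∈ A.normalizers :=
  ⟨star_mem hv.1, by rw [star_star, star_mul_self_mul_star hv.2.1],
    fun d hd => by rw [star_star]; exact (hv.2.2 d hd).symm⟩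

theorem star_mul_self_mem (hv : v ∈ A.normalizers) : star v * v ∈ A.D := by
  simpa only [star_star] using mul_star_self_mem (star_mem_normalizers hv)

theorem mul_mem_normalizers (hv : v ∈ A.normalizers) (hw : w ∈ A.normalizers) :
    v * w ∈ A.normalizers := by
  refine ⟨mul_mem hv.1 hw.1, mul_mul_star_mul_mul hv.2.1 hw.2.1
    (commute (star_mul_self_mem hv) (mul_star_self_mem hw)), fun d hd => ⟨?_, ?_⟩⟩
  · simpa only [star_mul, mul_assoc] using (hv.2.2 _ (hw.2.2 d hd).1).1
  · simpa only [star_mul, mul_assoc] using (hw.2.2 _ (hv.2.2 d hd).2).2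

theorem mem_normalizers_of_isStarProjection (hv : IsStarProjection v) (hD : v ∈ A.D) :
    v ∈ A.normalizers := by
  refine ⟨A.D_le hD, ?_, fun d hd => ?_⟩
  · rw [hv.isSelfAdjoint.star_eq, hv.isIdempotentElem.eq, hv.isIdempotentElem.eq]
  · rw [hv.isSelfAdjoint.star_eq]
    exact ⟨mul_mem (mul_mem hD hd) hD, mul_mem (mul_mem hD hd) hD⟩

theorem mem_D_of_isIdempotentElem (hv : v ∈ A.normalizers) (hi : IsIdempotentElem v) :
    v ∈ A.D := by
  have hs : IsSelfAdjoint v := isSelfAdjoint_of_isIdempotentElem hv.2.1 hi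
    (commute (star_mul_self_mem hv) (mul_star_self_mem hv))
  have h := star_mul_self_mem hv
  rwa [hs.star_eq, hi.eq] at h

theorem isStarProjection_of_isIdempotentElem (hv : v ∈ A.D) (hi : IsIdempotentElem v) :
    IsStarProjection v :=
  isStarProjection_iff_isIdempotentElem_and_isStarNormal.2
    ⟨hi, ⟨commute (star_mem hv) hv⟩⟩

theorem mem_normalizers_of_isOrthogonalSum {ι : Type*} {u : ι → H →L[ℂ] H}
    (h : IsOrthogonalSum u v) (hv : v ∈ A.M) (hu : ∀ i, u i ∈ A.normalizers) :
    v ∈ A.normalizers := by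
  refine ⟨hv, h.mul_star_mul_self, fun d hd => ⟨?_, ?_⟩⟩
  · exact h.conj_mem (fun i => commute hd (star_mul_self_mem (hu i)))
      (fun i => mul_star_self_mem (hu i)) fun i => ((hu i).2.2 d hd).1
  · have hconj : star v * d * star (star v) ∈ A.D :=
      h.star.conj_mem (fun i => commute hd (star_mul_self_mem (star_mem_normalizers (hu i))))
        (fun i => mul_star_self_mem (star_mem_normalizers (hu i)))
        fun i => ((star_mem_normalizers (hu i)).2.2 d hd).1
    rwa [star_star] at hconj

variable (A)

/-- The inverse monoid of groupoid normalizers. -/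
def Normalizer : Type u := A.normalizers

instance : Monoid A.Normalizer where
  mul v w := ⟨v.1 * w.1, mul_mem_normalizers v.2 w.2⟩
  one := ⟨1, mem_normalizers_of_isStarProjection (.one _) (one_mem A.D.toStarSubalgebra)⟩
  mul_assoc u v w := Subtype.ext (mul_assoc u.1 v.1 w.1)
  one_mul v := Subtype.ext (one_mul v.1)
  mul_one v := Subtype.ext (mul_one v.1)

variable {A} in
theorem Normalizer.mem_D {e : A.Normalizer} (he : e * e = e) : e.1 ∈ A.D :=
  mem_D_of_isIdempotentElem e.2 (congrArg Subtype.val he)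

noncomputable instance : InverseMonoid A.Normalizer where
  inv v := ⟨star v.1, star_mem_normalizers v.2⟩
  mul_inv_mul v := Subtype.ext v.2.2.1
  inv_mul_inv v := Subtype.ext (star_mul_self_mul_star v.2.2.1)
  eq_inv v _ h₁ h₂ := InverseMonoid.inv_unique_of_comm (S := A.Normalizer)
    (fun _ _ he hf => Subtype.ext (commute (Normalizer.mem_D he) (Normalizer.mem_D hf)))
    h₁ h₂ (Subtype.ext v.2.2.1) (Subtype.ext (star_mul_self_mul_star v.2.2.1))

open InverseMonoid

/-- The idempotent normalizers are the projections of `D`. -/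
def idemEquiv : Idem A.Normalizer ≃ {a : A.D.toStarSubalgebra // IsIdempotentElem a} where
  toFun e := ⟨⟨e.1.1, Normalizer.mem_D e.2⟩, Subtype.ext (congrArg Subtype.val e.2 :)⟩
  invFun a :=
    have ha : IsIdempotentElem a.1.1 := congrArg Subtype.val a.2
    ⟨⟨a.1.1, mem_normalizers_of_isStarProjection
      (isStarProjection_of_isIdempotentElem a.1.2 ha) a.1.2⟩, Subtype.ext ha⟩
  left_inv _ := rfl
  right_inv _ := rfl

/-- The clopen sets of the spectrum of `D` as idempotent normalizers. -/
noncomputable def idemIsoClopens : Idem A.Normalizer ≃o Clopens (gelfandSpectrum A.D) where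
  toEquiv := A.idemEquiv.trans (idempotentIsoClopens A.D.toStarSubalgebra).toEquiv
  map_rel_iff' {e f} := by
    refine (idempotentIsoClopens A.D.toStarSubalgebra).map_rel_iff'.trans ?_
    rw [idem_le_iff, idem_comm _ _ f.2 e.2]
    exact ⟨fun h => Subtype.ext (congrArg Subtype.val h :),
      fun h => Subtype.ext (congrArg Subtype.val h :)⟩

instance : Zero A.Normalizer where
  zero := ⟨0, mem_normalizers_of_isStarProjection (.zero _) (zero_mem A.D.toStarSubalgebra)⟩

theorem isZeroElem_zero : IsZeroElem (0 : A.Normalizer) := fun v =>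
  ⟨Subtype.ext (mul_zero v.1), Subtype.ext (zero_mul v.1)⟩

variable {A}

theorem val_eq_zero {v : A.Normalizer} (hv : IsZeroElem v) : v.1 = 0 :=
  congrArg Subtype.val (hv.eq A.isZeroElem_zero)

theorem isLUB_source {F : Set A.Normalizer} {v : A.Normalizer}
    (h : IsRangeProjection (Set.range fun u : F => star u.1.1 * u.1.1) (star v.1 * v.1)) :
    IsLUB (source '' F) (source v) := by
  constructor
  · rintro _ ⟨u, hu, rfl⟩
    exact idem_le_iff.2 (Subtype.ext (h.mul_eq _ ⟨⟨u, hu⟩, rfl⟩))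
  · intro f hf
    have hfv : (f.1.1 - 1) * (star v.1 * v.1) = 0 :=
      h.mul_eq_zero _ <| Set.forall_mem_range.2 fun u => by
        have hfu : f.1.1 * (star u.1.1 * u.1.1) = star u.1.1 * u.1.1 :=
          congrArg Subtype.val (idem_le_iff (S := A.Normalizer).1 (hf ⟨u, u.2, rfl⟩))
        rw [sub_mul, hfu, one_mul, sub_self]
    rw [sub_mul, one_mul, sub_eq_zero] at hfv
    exact idem_le_iff.2 (Subtype.ext hfv)

variable (A)

theorem hasOrthogonalGluing : HasOrthogonalGluing A.Normalizer := by
  intro F hF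
  have hne {u w : F} (h : u ≠ w) : Orthogonal u.1 w.1 := hF u.2 w.2 (Subtype.coe_ne_coe.2 h)
  obtain ⟨v, hvM, hv⟩ := exists_isOrthogonalSum (N := A.M) (u := fun u : F => u.1.1)
    (fun u => u.1.2.1) (fun u => u.1.2.2.1) (fun _ _ h => val_eq_zero (hne h.symm).2)
    (fun _ _ h => val_eq_zero (hne h).1)
  let v' : A.Normalizer := ⟨v, mem_normalizers_of_isOrthogonalSum hv hvM fun u => u.1.2⟩
  exact ⟨v', fun u hu => le_iff_mul_source_eq.2 (Subtype.ext (hv.mul_initial ⟨u, hu⟩)),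
    isLUB_source hv.initial⟩

end AbelianInclusion

theorem proposition3p5_general (A : AbelianInclusion H) :
    InverseMonoid.IsCartan (InverseMonoid.MunnQuotient A.Normalizer) :=
  InverseMonoid.MunnQuotient.isCartan (isHyperstonean_gelfandSpectrum A.D)
    A.idemIsoClopens A.isZeroElem_zero
    A.hasOrthogonalGluing

namespace CartanPair

/-- The double commutant of a maximal abelian subalgebra is abelian, so it is the subalgebra
itself. -/
theorem centralizer_centralizer_D (P : CartanPair H) :
    (P.D : Set (H →L[ℂ] H)).centralizer.centralizer = P.D := by
  let B := StarSubalgebra.centralizer ℂ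
    (StarSubalgebra.centralizer ℂ (P.D : Set (H →L[ℂ] H)) : Set (H →L[ℂ] H))
  have hB : (B : Set (H →L[ℂ] H)) = (P.D : Set (H →L[ℂ] H)).centralizer.centralizer := by
    rw [StarSubalgebra.coe_centralizer_centralizer, StarMemClass.star_coe_eq, Set.union_self]
  have hDB : P.D ≤ B := fun x hx => hB.ge (Set.subset_centralizer_centralizer hx)
  have hBM : B ≤ P.M.toStarSubalgebra := fun x hx =>
    P.M.centralizer_centralizer'.le
      (Set.centralizer_subset (Set.centralizer_subset P.D_le) (hB.le hx))
  have hcomm : ∀ x ∈ B, ∀ y ∈ B, x * y = y * x := fun x hx y hy =>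
    Set.centralizer_centralizer_comm_of_comm P.D_comm x (hB.le hx) y (hB.le hy)
  rw [← hB, P.isMASA.eq_of_le ⟨hBM, hcomm⟩ hDB]

/-- A Cartan pair, viewed as an inclusion of von Neumann algebras. -/
def toAbelianInclusion (P : CartanPair H) : AbelianInclusion H where
  M := P.M
  D := { P.D with centralizer_centralizer' := P.centralizer_centralizer_D }
  D_le := P.D_le
  isMulCommutative := ⟨⟨fun x y => Subtype.ext (P.D_comm x x.2 y y.2)⟩⟩

end CartanPair

end AbelianInclusion

theorem proposition3p5 {H : Type u} [NormedAddCommGroup H] [InnerProductSpace ℂ H]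
    [CompleteSpace H] (P : CartanPair H) : InverseMonoid.IsCartan P.S :=
  proposition3p5_general P.toAbelianInclusion
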